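/- Let $(\overline M,\overline g)$ be a semi-Riemannian manifold of constant sectional curvature $c$, with Levi-Civita connection $\overline\nabla$, and let $(M,g)$ be a lightlike hypersurface of $\overline M$: an immersed submanifold of codimension one, with induced metric $g$, whose radical $\mathrm{Rad}\,TM=TM\cap TM^{\perp}$ is a smooth distribution of rank one. A screen distribution is a smooth distribution $S(TM)$ with $TM=\mathrm{Rad}\,TM\perp S(TM)$ on which $g$ is nondegenerate. It determines the line bundle $\mathrm{tr}(TM)$ spanned locally by the null sections $N$ orthogonal to $S(TM)$ with $\overline g(\xi,N)=1$ for a local section $\xi$ of $\mathrm{Rad}\,TM$, and then, for $X,Y\in\Gamma(TM)$, the induced connection $\nabla$ and the second fundamental form $h$ through $\overline\nabla_XY=\nabla_XY+h(X,Y)$, with $\nabla_XY\in\Gamma(TM)$ and $h(X,Y)\in\Gamma(\mathrm{tr}(TM))$. Let $R(X,Y)Z=\nabla_X\nabla_YZ-\nabla_Y\nabla_XZ-\nabla_{[X,Y]}Z$ and $R(X,Y,Z,T)=g(R(X,Y)Z,T)$ be the induced curvature. The screen distribution is called admissible if $R$ is an algebraic curvature tensor, that is, for all $X,Y,Z,W\in\Gamma(TM)$,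 $$R(X,Y,Z,W)=-R(Y,X,Z,W)=R(Z,W,X,Y),\qquad R(X,Y,Z,W)+R(Y,Z,X,W)+R(Z,X,Y,W)=0.$$ Suppose that $M$ is totally umbilical: for some screen distribution there is a smooth section $H$ of $\mathrm{tr}(TM)$ with $h(X,Y)=g(X,Y)H$ for all $X,Y\in\Gamma(TM)$ (a property that does not depend on the screen distribution; $H$ may be nowhere zero, the proper case, or may have zeros). Then for every admissible screen distribution $S(TM)$ the lightlike hypersurface $(M,g,S(TM))$ is semi-symmetric: for all $V_1,V_2,X,Y,Z,T\in\Gamma(TM)$, $$(R(V_1,V_2)\cdot R)(X,Y,Z,T)=-R(R(V_1,V_2)X,Y,Z,T)-R(X,R(V_1,V_2)Y,Z,T)-R(X,Y,R(V_1,V_2)Z,T)-R(X,Y,Z,R(V_1,V_2)T)=0.$$ -/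

import Mathlib

open scoped Manifold ContDiff Topology
open Bundle

namespace LightlikeGeometry

noncomputable section

/-! ## Manifolds, vector fields, connections

`M` is a manifold (without boundary) modelled on the finite-dimensional space `E`, and `N` one
modelled on `F`.  `M` plays the role of the hypersurface and `N` that of the ambient manifold. -/

variable {E : Type*} [NormedAddCommGroup E] [NormedSpace ℝ E]
  {F : Type*} [NormedAddCommGroup F] [NormedSpace ℝ F]
  {M : Type*} [TopologicalSpace M] [ChartedSpace E M]
  {N : Type*} [TopologicalSpace N] [ChartedSpace F N]

/-- The vector field `X` on `M` is smooth, i.e. `X ∈ Γ(TM)`. -/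
def IsSmoothField [IsManifold 𝓘(ℝ, E) ∞ M] (X : Π x : M, TangentSpace 𝓘(ℝ, E) x) : Prop :=
  ContMDiff 𝓘(ℝ, E) 𝓘(ℝ, E).tangent ∞ (fun x ↦ (⟨x, X x⟩ : TangentBundle 𝓘(ℝ, E) M))

/-- `D` is a smooth distribution of rank `r` on `M`: near every point it is spanned by `r`
smooth pointwise linearly independent vector fields. -/
def IsSmoothDistribution [IsManifold 𝓘(ℝ, E) ∞ M]
    (D : Π x : M, Submodule ℝ (TangentSpace 𝓘(ℝ, E) x)) (r : ℕ) : Prop :=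
  ∀ x : M, ∃ U ∈ 𝓝 x, ∃ X : Fin r → Π y : M, TangentSpace 𝓘(ℝ, E) y,
    (∀ i, ContMDiffOn 𝓘(ℝ, E) 𝓘(ℝ, E).tangent ∞
      (fun y ↦ (⟨y, X i y⟩ : TangentBundle 𝓘(ℝ, E) M)) U) ∧
    ∀ y ∈ U, LinearIndependent ℝ (fun i ↦ X i y) ∧
      Submodule.span ℝ (Set.range fun i ↦ X i y) = D y

/-- The curvature operator `R(X,Y)Z = ∇_X ∇_Y Z - ∇_Y ∇_X Z - ∇_[X,Y] Z` of the operator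
`(X, Y) ↦ D X Y = ∇_X Y` on vector fields. -/
def curvature
    (D : (Π x : M, TangentSpace 𝓘(ℝ, E) x) → (Π x : M, TangentSpace 𝓘(ℝ, E) x) →
      (Π x : M, TangentSpace 𝓘(ℝ, E) x))
    (X Y Z : Π x : M, TangentSpace 𝓘(ℝ, E) x) : Π x : M, TangentSpace 𝓘(ℝ, E) x :=
  fun x ↦ D X (D Y Z) x - D Y (D X Z) x - D (VectorField.mlieBracket 𝓘(ℝ, E) X Y) Z x

/-! ## Semi-Riemannian ambient manifolds -/

variable (F N) in
/-- A semi-Riemannian metric on `N`: a smooth field of nondegenerate symmetric bilinear forms of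
constant index (the index being the maximal dimension of a negative definite subspace). -/
structure SemiRiemannianMetric [IsManifold 𝓘(ℝ, F) ∞ N] where
  /-- the scalar product on the tangent spaces -/
  val (q : N) : TangentSpace 𝓘(ℝ, F) q →L[ℝ] TangentSpace 𝓘(ℝ, F) q →L[ℝ] ℝ
  symm (q : N) (v w : TangentSpace 𝓘(ℝ, F) q) : val q v w = val q w v
  nondegenerate (q : N) (v : TangentSpace 𝓘(ℝ, F) q) (hv : ∀ w, val q v w = 0) : v = 0
  contMDiff : ContMDiff 𝓘(ℝ, F) (𝓘(ℝ, F).prod 𝓘(ℝ, F →L[ℝ] F →L[ℝ] ℝ)) ∞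
    (fun q ↦ TotalSpace.mk' (F →L[ℝ] F →L[ℝ] ℝ)
      (E := fun q : N ↦ TangentSpace 𝓘(ℝ, F) q →L[ℝ] TangentSpace 𝓘(ℝ, F) q →L[ℝ] ℝ) q (val q))
  /-- the index of the metric -/
  index : ℕ
  isGreatest_index (q : N) :
    IsGreatest {k : ℕ | ∃ W : Submodule ℝ (TangentSpace 𝓘(ℝ, F) q),
      Module.finrank ℝ W = k ∧ ∀ w ∈ W, w ≠ 0 → val q w w < 0} index

/-- `nabla` is the Levi-Civita connection of the semi-Riemannian metric `g`: it is smooth,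
torsion-free and metric.  In the notation of `CovariantDerivative`, `nabla Y q v = ∇_v Y`. -/
structure IsLeviCivita [FiniteDimensional ℝ F] [IsManifold 𝓘(ℝ, F) ∞ N]
    (g : SemiRiemannianMetric F N)
    (nabla : CovariantDerivative 𝓘(ℝ, F) F (TangentSpace 𝓘(ℝ, F) : N → Type _)) : Prop where
  smooth : nabla.ContMDiffCovariantDerivative ∞
  torsion_free : nabla.torsion = 0
  metric : ∀ (Y Z : Π q : N, TangentSpace 𝓘(ℝ, F) q) (q : N),
    MDifferentiableAt 𝓘(ℝ, F) 𝓘(ℝ, F).tangent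
      (fun p ↦ (⟨p, Y p⟩ : TangentBundle 𝓘(ℝ, F) N)) q →
    MDifferentiableAt 𝓘(ℝ, F) 𝓘(ℝ, F).tangent
      (fun p ↦ (⟨p, Z p⟩ : TangentBundle 𝓘(ℝ, F) N)) q →
    ∀ v : TangentSpace 𝓘(ℝ, F) q,
      mvfderiv 𝓘(ℝ, F) (fun p ↦ g.val p (Y p) (Z p)) q v =
        g.val q (nabla Y q v) (Z q) + g.val q (Y q) (nabla Z q v)

/-- `N` has constant sectional curvature `c`: every nondegenerate tangent plane, spanned by `X q`
and `Y q`, has sectional curvature `g(R(X,Y)Y,X) / (g(X,X)g(Y,Y) - g(X,Y)²) = c`. -/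
def HasConstantSectionalCurvature [IsManifold 𝓘(ℝ, F) ∞ N] (g : SemiRiemannianMetric F N)
    (nabla : CovariantDerivative 𝓘(ℝ, F) F (TangentSpace 𝓘(ℝ, F) : N → Type _)) (c : ℝ) : Prop :=
  ∀ X Y : Π q : N, TangentSpace 𝓘(ℝ, F) q, IsSmoothField X → IsSmoothField Y → ∀ q : N,
    g.val q (X q) (X q) * g.val q (Y q) (Y q) - g.val q (X q) (Y q) ^ 2 ≠ 0 →
    g.val q (curvature (fun V W p ↦ nabla W p (V p)) X Y Y q) (X q) /
      (g.val q (X q) (X q) * g.val q (Y q) (Y q) - g.val q (X q) (Y q) ^ 2) = c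

/-- The covariant derivative `∇_v V` of a vector field `V` along a map `ι : M → N`
(`V y ∈ T_{ι y} N`) in the direction `v ∈ T_x M`, i.e. the pullback connection on `ι^* TN`.
With `e` the trivialization of `TN` around `ι x` given by a chart, `V^` the representation of `V`
in `e` and `E_w` the local field on `N` whose representation in `e` is the constant vector `w`, it
is `e⁻¹ (d V^ (v)) + (∇_{dι v} E_w) (ι x)` with `w = V^ x`. -/
def covAlong [IsManifold 𝓘(ℝ, F) ∞ N]
    (nabla : CovariantDerivative 𝓘(ℝ, F) F (TangentSpace 𝓘(ℝ, F) : N → Type _)) (ι : M → N)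
    (V : Π y : M, TangentSpace 𝓘(ℝ, F) (ι y)) (x : M) (v : TangentSpace 𝓘(ℝ, E) x) :
    TangentSpace 𝓘(ℝ, F) (ι x) :=
  let e := trivializationAt F (TangentSpace 𝓘(ℝ, F) : N → Type _) (ι x)
  let coord : M → F := fun y ↦ (e (⟨ι y, V y⟩ : TangentBundle 𝓘(ℝ, F) N)).2
  e.symm (ι x) (mvfderiv 𝓘(ℝ, E) coord x v) +
    nabla (fun q ↦ e.symm q (coord x)) (ι x) (mfderiv 𝓘(ℝ, E) 𝓘(ℝ, F) ι x v)

/-! ## Lightlike hypersurfaces -/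

/-- The (degenerate) metric `g = ι^* gbar` induced on `M`. -/
def inducedMetric [IsManifold 𝓘(ℝ, F) ∞ N] (g : SemiRiemannianMetric F N) (ι : M → N) (x : M)
    (u v : TangentSpace 𝓘(ℝ, E) x) : ℝ :=
  g.val (ι x) (mfderiv 𝓘(ℝ, E) 𝓘(ℝ, F) ι x u) (mfderiv 𝓘(ℝ, E) 𝓘(ℝ, F) ι x v)

/-- The radical distribution `Rad T_x M = T_x M ∩ T_x M^⊥`. -/
def radical [IsManifold 𝓘(ℝ, F) ∞ N] (g : SemiRiemannianMetric F N) (ι : M → N) (x : M) :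
    Submodule ℝ (TangentSpace 𝓘(ℝ, E) x) where
  carrier := {u | ∀ v, inducedMetric g ι x u v = 0}
  add_mem' := by
    intro a b ha hb v
    have ha' := ha v
    have hb' := hb v
    simp only [inducedMetric] at ha' hb' ⊢
    simp [ha', hb']
  zero_mem' := by
    intro v
    simp [inducedMetric]
  smul_mem' := by
    intro a b hb v
    have hb' := hb v
    simp only [inducedMetric] at hb' ⊢
    simp [hb']

/-- `ι : M → N` is a lightlike hypersurface: an immersed submanifold of codimension one whose
radical distribution is a smooth distribution of rank one. -/
structure IsLightlikeHypersurface [IsManifold 𝓘(ℝ, E) ∞ M] [IsManifold 𝓘(ℝ, F) ∞ N]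
    (g : SemiRiemannianMetric F N) (ι : M → N) : Prop where
  immersion : Manifold.IsImmersion 𝓘(ℝ, E) 𝓘(ℝ, F) ∞ ι
  codim : Module.finrank ℝ F = Module.finrank ℝ E + 1
  radical_smooth : IsSmoothDistribution (radical (E := E) g ι) 1

/-- A screen distribution `S(TM)`: a smooth distribution complementary to the radical in `TM`, on
which the induced metric is nondegenerate. -/
structure ScreenDistribution [IsManifold 𝓘(ℝ, E) ∞ M] [IsManifold 𝓘(ℝ, F) ∞ N]
    (g : SemiRiemannianMetric F N) (ι : M → N) where
  /-- the underlying field of subspaces -/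
  space (x : M) : Submodule ℝ (TangentSpace 𝓘(ℝ, E) x)
  smooth : ∃ k : ℕ, IsSmoothDistribution space k
  isCompl (x : M) : IsCompl (space x) (radical g ι x)
  nondegenerate (x : M) : ∀ u ∈ space x, (∀ v ∈ space x, inducedMetric g ι x u v = 0) → u = 0

section Induced

variable [IsManifold 𝓘(ℝ, E) ∞ M] [IsManifold 𝓘(ℝ, F) ∞ N]
  {g : SemiRiemannianMetric F N} {ι : M → N}

/-- The fibre at `x` of the lightlike transversal bundle `tr(TM)` of the screen `S`: the line
spanned by the null vectors `n ∈ T_{ι x} N` orthogonal to the screen with `gbar(ξ, n) = 1` for some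
`ξ` in the radical. -/
def transversal (S : ScreenDistribution (E := E) g ι) (x : M) :
    Submodule ℝ (TangentSpace 𝓘(ℝ, F) (ι x)) :=
  Submodule.span ℝ {n | (∀ s ∈ S.space x, g.val (ι x) (mfderiv 𝓘(ℝ, E) 𝓘(ℝ, F) ι x s) n = 0) ∧
    g.val (ι x) n n = 0 ∧
    ∃ ξ ∈ radical g ι x, g.val (ι x) (mfderiv 𝓘(ℝ, E) 𝓘(ℝ, F) ι x ξ) n = 1}

/-- The tangential component of `V ∈ T_{ι x} N` in the decomposition
`T_{ι x} N = dι(T_x M) ⊕ tr(TM)_x`, as a vector of `T_x M`: the unique `u` with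
`V - dι u ∈ tr(TM)_x`. -/
def tangentialPart (S : ScreenDistribution (E := E) g ι) (x : M)
    (V : TangentSpace 𝓘(ℝ, F) (ι x)) : TangentSpace 𝓘(ℝ, E) x :=
  Classical.epsilon fun u ↦ V - mfderiv 𝓘(ℝ, E) 𝓘(ℝ, F) ι x u ∈ transversal S x

/-- The ambient derivative `∇bar_X Y ∈ T N|_M` of vector fields `X, Y` on `M`. -/
def ambientDeriv
    (nabla : CovariantDerivative 𝓘(ℝ, F) F (TangentSpace 𝓘(ℝ, F) : N → Type _)) (ι : M → N)
    (X Y : Π x : M, TangentSpace 𝓘(ℝ, E) x) (x : M) : TangentSpace 𝓘(ℝ, F) (ι x) :=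
  covAlong nabla ι (fun y ↦ mfderiv 𝓘(ℝ, E) 𝓘(ℝ, F) ι y (Y y)) x (X x)

/-- The induced connection `∇_X Y` on `M`, from the Gauss formula `∇bar_X Y = ∇_X Y + h(X,Y)`. -/
def inducedConnection
    (nabla : CovariantDerivative 𝓘(ℝ, F) F (TangentSpace 𝓘(ℝ, F) : N → Type _))
    (S : ScreenDistribution (E := E) g ι)
    (X Y : Π x : M, TangentSpace 𝓘(ℝ, E) x) : Π x : M, TangentSpace 𝓘(ℝ, E) x :=
  fun x ↦ tangentialPart S x (ambientDeriv nabla ι X Y x)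

/-- The second fundamental form `h(X,Y) = ∇bar_X Y - ∇_X Y` of `(M, g, S(TM))`. -/
def secondFundamentalForm
    (nabla : CovariantDerivative 𝓘(ℝ, F) F (TangentSpace 𝓘(ℝ, F) : N → Type _))
    (S : ScreenDistribution (E := E) g ι)
    (X Y : Π x : M, TangentSpace 𝓘(ℝ, E) x) (x : M) : TangentSpace 𝓘(ℝ, F) (ι x) :=
  ambientDeriv nabla ι X Y x -
    mfderiv 𝓘(ℝ, E) 𝓘(ℝ, F) ι x (inducedConnection nabla S X Y x)

/-- The induced Riemann curvature `R(X,Y)Z` of `(M, g, S(TM))`. -/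
def inducedCurvature
    (nabla : CovariantDerivative 𝓘(ℝ, F) F (TangentSpace 𝓘(ℝ, F) : N → Type _))
    (S : ScreenDistribution (E := E) g ι)
    (X Y Z : Π x : M, TangentSpace 𝓘(ℝ, E) x) : Π x : M, TangentSpace 𝓘(ℝ, E) x :=
  curvature (inducedConnection nabla S) X Y Z

/-- The `(0,4)` induced curvature tensor `R(X,Y,Z,T) = g(R(X,Y)Z, T)`. -/
def inducedCurvatureForm
    (nabla : CovariantDerivative 𝓘(ℝ, F) F (TangentSpace 𝓘(ℝ, F) : N → Type _))
    (S : ScreenDistribution (E := E) g ι)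
    (X Y Z T : Π x : M, TangentSpace 𝓘(ℝ, E) x) (x : M) : ℝ :=
  inducedMetric g ι x (inducedCurvature nabla S X Y Z x) (T x)

/-- The screen distribution `S(TM)` is admissible: the induced Riemann curvature is an algebraic
curvature tensor. -/
def IsAdmissible
    (nabla : CovariantDerivative 𝓘(ℝ, F) F (TangentSpace 𝓘(ℝ, F) : N → Type _))
    (S : ScreenDistribution (E := E) g ι) : Prop :=
  ∀ X Y Z W : Π x : M, TangentSpace 𝓘(ℝ, E) x,
    IsSmoothField X → IsSmoothField Y → IsSmoothField Z → IsSmoothField W → ∀ x : M,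
      inducedCurvatureForm nabla S X Y Z W x = - inducedCurvatureForm nabla S Y X Z W x ∧
      inducedCurvatureForm nabla S X Y Z W x = inducedCurvatureForm nabla S Z W X Y x ∧
      inducedCurvatureForm nabla S X Y Z W x + inducedCurvatureForm nabla S Y Z X W x +
        inducedCurvatureForm nabla S Z X Y W x = 0

/-- `(R(V₁,V₂) · R)(X,Y,Z,T)`: the curvature operator `R(V₁,V₂)` acting as a derivation on the
`(0,4)` induced curvature tensor. -/
def curvatureDerivation
    (nabla : CovariantDerivative 𝓘(ℝ, F) F (TangentSpace 𝓘(ℝ, F) : N → Type _))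
    (S : ScreenDistribution (E := E) g ι)
    (V₁ V₂ X Y Z T : Π x : M, TangentSpace 𝓘(ℝ, E) x) (x : M) : ℝ :=
  - inducedCurvatureForm nabla S (inducedCurvature nabla S V₁ V₂ X) Y Z T x
  - inducedCurvatureForm nabla S X (inducedCurvature nabla S V₁ V₂ Y) Z T x
  - inducedCurvatureForm nabla S X Y (inducedCurvature nabla S V₁ V₂ Z) T x
  - inducedCurvatureForm nabla S X Y Z (inducedCurvature nabla S V₁ V₂ T) x

/-- The lightlike hypersurface `(M, g, S(TM))` is semi-symmetric: `R · R = 0`. -/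
def IsSemiSymmetric
    (nabla : CovariantDerivative 𝓘(ℝ, F) F (TangentSpace 𝓘(ℝ, F) : N → Type _))
    (S : ScreenDistribution (E := E) g ι) : Prop :=
  ∀ V₁ V₂ X Y Z T : Π x : M, TangentSpace 𝓘(ℝ, E) x,
    IsSmoothField V₁ → IsSmoothField V₂ → IsSmoothField X → IsSmoothField Y →
    IsSmoothField Z → IsSmoothField T → ∀ x : M,
      curvatureDerivation nabla S V₁ V₂ X Y Z T x = 0

end Induced

/-- `ι : M → N` is totally umbilical: for some screen distribution there is a smooth section `H`
of `tr(TM)` with `h(X,Y) = g(X,Y) H` for all `X, Y ∈ Γ(TM)`.  (For a hypersurface this property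
does not depend on the screen distribution.) -/
def IsTotallyUmbilical [IsManifold 𝓘(ℝ, E) ∞ M] [IsManifold 𝓘(ℝ, F) ∞ N]
    (g : SemiRiemannianMetric F N)
    (nabla : CovariantDerivative 𝓘(ℝ, F) F (TangentSpace 𝓘(ℝ, F) : N → Type _)) (ι : M → N) :
    Prop :=
  ∃ (S : ScreenDistribution (E := E) g ι) (H : Π x : M, TangentSpace 𝓘(ℝ, F) (ι x)),
    ContMDiff 𝓘(ℝ, E) 𝓘(ℝ, F).tangent ∞
      (fun x ↦ (⟨ι x, H x⟩ : TangentBundle 𝓘(ℝ, F) N)) ∧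
    (∀ x, H x ∈ transversal S x) ∧
    ∀ X Y : Π x : M, TangentSpace 𝓘(ℝ, E) x, IsSmoothField X → IsSmoothField Y → ∀ x : M,
      secondFundamentalForm nabla S X Y x = inducedMetric g ι x (X x) (Y x) • H x

end

end LightlikeGeometry

/-!
Constancy of the sectional curvature gives `R̄(u,v)w = c (ḡ(v,w) u - ḡ(u,w) v)`: the difference of
the two sides is an algebraic curvature tensor that vanishes on all nondegenerate planes, hence,
since these are dense on a suitable line through any given plane, on all planes.

If `H` is the section of the transversal bundle of some screen with `h = g ⊗ H`, then for any other
screen `h = g ⊗ H'`, where `H'` is the transversal part of `H`. When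
`∇̄_X Y = ∇_X Y + g(X,Y) H'` is differentiated, the derivatives of `g(X,Y)` multiply `H'`, so they
disappear on taking tangential parts, which leaves the Gauss equation
`R(X,Y)Z = g(Y,Z) L X - g(X,Z) L Y` with `L u = c u - (∇̄_u H')^tan`.

Admissibility forces the pair symmetry of `R`, which for a curvature of this form means
`g(L X, W) = μ g(X, W)` at each point, although `g` is degenerate and `L` need not be a multiple of
the identity. Thus `R(X,Y,Z,W) = μ (g(Y,Z) g(X,W) - g(X,Z) g(Y,W))`; in particular `R(V₁,V₂)` is
skew for `g`, and a skew derivation annihilates every tensor built from `g`.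
-/

namespace LightlikeGeometry

noncomputable section

/-! ### Calculus on manifolds -/

section Calculus

variable {E : Type*} [NormedAddCommGroup E] [NormedSpace ℝ E]
  {F : Type*} [NormedAddCommGroup F] [NormedSpace ℝ F]
  {G : Type*} [NormedAddCommGroup G] [NormedSpace ℝ G]
  {G₁ : Type*} [NormedAddCommGroup G₁] [NormedSpace ℝ G₁]
  {G₂ : Type*} [NormedAddCommGroup G₂] [NormedSpace ℝ G₂]
  {M : Type*} [TopologicalSpace M] [ChartedSpace E M]
  {N : Type*} [TopologicalSpace N] [ChartedSpace F N]

theorem mvfderiv_congr_of_eventuallyEq {f f' : M → G} {x : M} (h : f =ᶠ[𝓝 x] f') :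
    d% f x = d% f' x := by
  ext v
  exact congrArg (fun L : E →L[ℝ] G ↦ L v)
    (h.mfderiv_eq (I := 𝓘(ℝ, E)) (I' := 𝓘(ℝ, G)) : (_ : E →L[ℝ] G) = _)

theorem mvfderiv_comp_mfderiv_apply {f : N → G} {ι : M → N} {x : M}
    (hf : MDiffAt f (ι x)) (hι : MDiffAt ι x) (u : TangentSpace 𝓘(ℝ, E) x) :
    d% (fun y : M ↦ f (ι y)) x u = d% f (ι x) (mfderiv% ι x u) := by
  have h := (HasMFDerivAt.comp x hf.hasMFDerivAt hι.hasMFDerivAt).mfderiv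
  exact congrArg (fun (L : E →L[ℝ] G) ↦ L u) (h : (_ : E →L[ℝ] G) = _)

theorem mvfderiv_clm_comp_apply (L : G₁ →L[ℝ] G) {f : M → G₁} {x : M} (hf : MDiffAt f x)
    (u : TangentSpace 𝓘(ℝ, E) x) :
    d% (fun y : M ↦ L (f y)) x u = L (d% f x u) := by
  have h := (HasMFDerivAt.comp x L.hasFDerivAt.hasMFDerivAt hf.hasMFDerivAt).mfderiv
  exact congrArg (fun (L : E →L[ℝ] G) ↦ L u) (h : (_ : E →L[ℝ] G) = _)

theorem mvfderiv_clm_apply₂ (B : G₁ →L[ℝ] G₂ →L[ℝ] G) {f : M → G₁} {k : M → G₂} {x : M}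
    (hf : MDiffAt f x) (hk : MDiffAt k x) (u : TangentSpace 𝓘(ℝ, E) x) :
    d% (fun y : M ↦ B (f y) (k y)) x u = B (d% f x u) (k x) + B (f x) (d% k x u) := by
  have hpair : HasMFDerivAt 𝓘(ℝ, E) 𝓘(ℝ, G₁ × G₂) (fun y ↦ (f y, k y)) x
      (ContinuousLinearMap.prod (d% f x) (d% k x)) :=
    ⟨ContinuousAt.prodMk hf.continuousAt hk.continuousAt,
      hf.hasMFDerivAt.2.prodMk hk.hasMFDerivAt.2⟩
  have hB := (B.isBoundedBilinearMap.hasFDerivAt (f x, k x)).hasMFDerivAt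
  have h := congrArg (fun (L : E →L[ℝ] G) ↦ L u)
    ((HasMFDerivAt.comp x hB hpair).mfderiv : (_ : E →L[ℝ] G) = _)
  rw [add_comm]
  exact h

theorem mvfderiv_clm_apply {c : M → G₁ →L[ℝ] G} {k : M → G₁} {x : M}
    (hc : MDiffAt c x) (hk : MDiffAt k x) (u : TangentSpace 𝓘(ℝ, E) x) :
    d% (fun y : M ↦ c y (k y)) x u = d% c x u (k x) + c x (d% k x u) :=
  mvfderiv_clm_apply₂ (ContinuousLinearMap.id ℝ (G₁ →L[ℝ] G)) hc hk u

theorem mvfderiv_clm_apply_apply {c : M → G₁ →L[ℝ] G₂ →L[ℝ] G} {f : M → G₁} {k : M → G₂} {x : M}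
    (hc : MDiffAt c x) (hf : MDiffAt f x) (hk : MDiffAt k x) (u : TangentSpace 𝓘(ℝ, E) x) :
    d% (fun y : M ↦ c y (f y) (k y)) x u =
      d% c x u (f x) (k x) + c x (d% f x u) (k x) + c x (f x) (d% k x u) := by
  rw [mvfderiv_clm_apply (hc.clm_apply hf) hk, mvfderiv_clm_apply hc hf, add_apply]

theorem contMDiffAt_clm_comp (L : G₁ →L[ℝ] G) {f : M → G₁} {x : M} (hf : CMDiffAt ∞ f x) :
    CMDiffAt ∞ (fun y ↦ L (f y)) x :=
  L.contDiff.contMDiff.contMDiffAt.comp x hf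

theorem contMDiffAt_smulRight (β : G₁ →L[ℝ] ℝ) {f : M → G} {x : M} (hf : CMDiffAt ∞ f x) :
    CMDiffAt ∞ (fun y ↦ β.smulRight (f y)) x :=
  contMDiffAt_clm_comp (ContinuousLinearMap.smulRightL ℝ G₁ G β) hf

theorem contMDiffAt_mfderiv_apply [IsManifold 𝓘(ℝ, E) ∞ M] [IsManifold 𝓘(ℝ, F) ∞ N]
    {f : M → N} {x : M} (hf : CMDiffAt ∞ f x) {X : Π y : M, TangentSpace 𝓘(ℝ, E) y}
    (hX : CMDiffAt ∞ (T% X) x) :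
    CMDiffAt ∞ (fun y ↦ (⟨f y, mfderiv% f y (X y)⟩ : TangentBundle 𝓘(ℝ, F) N)) x :=
  ContMDiffAt.clm_apply_of_inCoordinates (b₁ := id) (b₂ := f)
    (hf.mfderiv_const (m := ∞) le_rfl) hX hf

theorem contMDiffAt_mvfderiv_apply [IsManifold 𝓘(ℝ, E) ∞ M] {f : M → G} {x : M}
    (hf : CMDiffAt ∞ f x) {X : Π y : M, TangentSpace 𝓘(ℝ, E) y} (hX : CMDiffAt ∞ (T% X) x) :
    CMDiffAt ∞ (fun y ↦ d% f y (X y)) x := by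
  have h := (contMDiffAt_totalSpace.1 (contMDiffAt_mfderiv_apply hf hX)).2
  refine h.congr_of_eventuallyEq (Filter.Eventually.of_forall fun y ↦ ?_)
  simp only [trivializationAt_model_space_apply]
  rfl

section LieBracket

/-- The representation of the vector field `Z` in the preferred chart around `x`, a field on the
model space. -/
def chartField (x : M) (Z : Π y : M, TangentSpace 𝓘(ℝ, E) y) : E → E :=
  VectorField.mpullbackWithin 𝓘(ℝ, E) 𝓘(ℝ, E) (extChartAt 𝓘(ℝ, E) x).symm Z (Set.range 𝓘(ℝ, E))

/-- The representation of the function `f` in the preferred chart around `x`. -/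
def chartFun {A : Type*} (x : M) (f : M → A) : E → A := f ∘ (extChartAt 𝓘(ℝ, E) x).symm

theorem contDiffAt_chartFun {f : M → G} {x : M} (hf : CMDiffAt ∞ f x) :
    ContDiffAt ℝ ∞ (chartFun x f) (extChartAt 𝓘(ℝ, E) x x) := by
  have h := (contMDiffAt_iff (I := 𝓘(ℝ, E)) (I' := 𝓘(ℝ, G)).1 hf).2
  rw [← contDiffWithinAt_univ]
  simpa [chartFun, Function.comp_def, extChartAt_model_space_eq_id] using! h

theorem eventuallyEq_chartFun_comp {A : Type*} {x y : M} (hy : y ∈ (extChartAt 𝓘(ℝ, E) x).source)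
    (f : M → A) :
    f =ᶠ[𝓝 y] chartFun x f ∘ extChartAt 𝓘(ℝ, E) x := by
  filter_upwards [extChartAt_source_mem_nhds' hy] with z hz
  exact (congrArg f ((extChartAt 𝓘(ℝ, E) x).left_inv hz)).symm

variable [IsManifold 𝓘(ℝ, E) ∞ M]

theorem chartField_extChartAt {x y : M} (hy : y ∈ (extChartAt 𝓘(ℝ, E) x).source)
    (Z : Π y : M, TangentSpace 𝓘(ℝ, E) y) :
    chartField x Z (extChartAt 𝓘(ℝ, E) x y) = mfderiv% (extChartAt 𝓘(ℝ, E) x) y (Z y) := by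
  set φ := extChartAt 𝓘(ℝ, E) x
  let D : E →L[ℝ] E := mfderiv[Set.range 𝓘(ℝ, E)] φ.symm (φ y)
  have hD : D.IsInvertible :=
    isInvertible_mfderivWithin_extChartAt_symm (I := 𝓘(ℝ, E)) (φ.map_source hy)
  have hinv : D (mfderiv% φ y (Z y)) = Z y :=
    congrArg (fun (L : E →L[ℝ] E) ↦ L (Z y))
      (mfderivWithin_extChartAt_symm_comp_mfderiv_extChartAt' (I := 𝓘(ℝ, E)) hy :
        (_ : E →L[ℝ] E) = _)
  have hrep : chartField x Z (φ y) = D.inverse (Z (φ.symm (φ y))) := rfl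
  rw [φ.left_inv hy] at hrep
  exact hrep.trans (hD.inverse_apply_eq.2 hinv.symm)

theorem differentiableAt_chartField [CompleteSpace E] {x : M} {Z : Π y : M, TangentSpace 𝓘(ℝ, E) y}
    (hZ : CMDiffAt ∞ (T% Z) x) :
    DifferentiableAt ℝ (chartField x Z) (extChartAt 𝓘(ℝ, E) x x) := by
  have h := MDifferentiableWithinAt.differentiableWithinAt_mpullbackWithin_vectorField
    (mdifferentiableWithinAt_univ.2 (hZ.mdifferentiableAt (by simp)))
  rw [← differentiableWithinAt_univ]
  simpa [chartField] using h

theorem mvfderiv_comp_extChartAt {x y : M} (hy : y ∈ (extChartAt 𝓘(ℝ, E) x).source) {k : E → G}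
    (hk : DifferentiableAt ℝ k (extChartAt 𝓘(ℝ, E) x y)) (Z : Π y : M, TangentSpace 𝓘(ℝ, E) y) :
    d% (k ∘ extChartAt 𝓘(ℝ, E) x) y (Z y) =
      fderiv ℝ k (extChartAt 𝓘(ℝ, E) x y) (chartField x Z (extChartAt 𝓘(ℝ, E) x y)) := by
  have h := mfderiv_comp y hk.mdifferentiableAt
    (mdifferentiableAt_extChartAt (I := 𝓘(ℝ, E)) (by simpa using hy))
  rw [mfderiv_eq_fderiv] at h
  rw [chartField_extChartAt hy]
  exact congrArg (fun (L : E →L[ℝ] G) ↦ L (Z y)) (h : (_ : E →L[ℝ] G) = _)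

theorem chartField_mlieBracket [CompleteSpace E] (x : M) (X Y : Π y : M, TangentSpace 𝓘(ℝ, E) y) :
    chartField x (VectorField.mlieBracket 𝓘(ℝ, E) X Y) (extChartAt 𝓘(ℝ, E) x x) =
      VectorField.lieBracket ℝ (chartField x X) (chartField x Y) (extChartAt 𝓘(ℝ, E) x x) := by
  set φ := extChartAt 𝓘(ℝ, E) x
  let D : E →L[ℝ] E := mfderiv% φ x
  have hD : D.IsInvertible :=
    isInvertible_mfderiv_extChartAt (I := 𝓘(ℝ, E)) (mem_extChartAt_source x)
  have hwithin : VectorField.lieBracketWithin ℝ (chartField x X) (chartField x Y)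
      (φ.symm ⁻¹' Set.univ ∩ Set.range 𝓘(ℝ, E)) (φ x) =
      VectorField.lieBracket ℝ (chartField x X) (chartField x Y) (φ x) := by
    rw [← VectorField.lieBracketWithin_univ]
    simp
  rw [chartField_extChartAt (mem_extChartAt_source x)]
  refine (hD.inverse_apply_eq.1 ?_).symm
  rw [← hwithin, ← VectorField.mlieBracketWithin_univ, VectorField.mlieBracketWithin_apply]
  rfl

theorem mvfderiv_apply_eventuallyEq {f : M → G} {x : M} (hf : CMDiffAt ∞ f x)
    (Z : Π y : M, TangentSpace 𝓘(ℝ, E) y) :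
    (fun y ↦ d% f y (Z y)) =ᶠ[𝓝 x]
      (fun p ↦ fderiv ℝ (chartFun x f) p (chartField x Z p)) ∘ extChartAt 𝓘(ℝ, E) x := by
  have hdiff : ∀ᶠ p in 𝓝 (extChartAt 𝓘(ℝ, E) x x), DifferentiableAt ℝ (chartFun x f) p := by
    have h1 : ContDiffAt ℝ 1 (chartFun x f) (extChartAt 𝓘(ℝ, E) x x) :=
      (contDiffAt_chartFun hf).of_le (by exact_mod_cast le_top)
    filter_upwards [h1.eventually (by simp)] with p hp using hp.differentiableAt one_ne_zero
  filter_upwards [extChartAt_source_mem_nhds (I := 𝓘(ℝ, E)) x,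
    (continuousAt_extChartAt (I := 𝓘(ℝ, E)) x).eventually hdiff] with y hy hd
  rw [mvfderiv_congr_of_eventuallyEq (eventuallyEq_chartFun_comp hy f),
    mvfderiv_comp_extChartAt hy hd, Function.comp]

variable [CompleteSpace E]

theorem mvfderiv_mvfderiv_apply {f : M → G} {x : M} (hf : CMDiffAt ∞ f x)
    {Z : Π y : M, TangentSpace 𝓘(ℝ, E) y} (hZ : CMDiffAt ∞ (T% Z) x)
    (W : Π y : M, TangentSpace 𝓘(ℝ, E) y) :
    d% (fun y : M ↦ d% f y (Z y)) x (W x) =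
      fderiv ℝ (fderiv ℝ (chartFun x f)) (extChartAt 𝓘(ℝ, E) x x)
          (chartField x W (extChartAt 𝓘(ℝ, E) x x)) (chartField x Z (extChartAt 𝓘(ℝ, E) x x)) +
        fderiv ℝ (chartFun x f) (extChartAt 𝓘(ℝ, E) x x)
          (fderiv ℝ (chartField x Z) (extChartAt 𝓘(ℝ, E) x x)
            (chartField x W (extChartAt 𝓘(ℝ, E) x x))) := by
  have hf2 : DifferentiableAt ℝ (fderiv ℝ (chartFun x f)) (extChartAt 𝓘(ℝ, E) x x) :=
    ((contDiffAt_chartFun hf).fderiv_right (m := ∞) le_rfl).differentiableAt (by simp)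
  have hZ' := differentiableAt_chartField hZ
  rw [mvfderiv_congr_of_eventuallyEq (mvfderiv_apply_eventuallyEq hf Z),
    mvfderiv_comp_extChartAt (mem_extChartAt_source x) (hf2.clm_apply hZ'),
    fderiv_clm_apply hf2 hZ']
  simp [add_comm]

theorem mvfderiv_mlieBracket {f : M → G} {x : M} (hf : CMDiffAt ∞ f x)
    {X Y : Π y : M, TangentSpace 𝓘(ℝ, E) y} (hX : CMDiffAt ∞ (T% X) x)
    (hY : CMDiffAt ∞ (T% Y) x) :
    d% f x (VectorField.mlieBracket 𝓘(ℝ, E) X Y x) =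
      d% (fun y : M ↦ d% f y (Y y)) x (X x) -
        d% (fun y : M ↦ d% f y (X y)) x (Y x) := by
  have hsymm : IsSymmSndFDerivAt ℝ (chartFun x f) (extChartAt 𝓘(ℝ, E) x x) :=
    (contDiffAt_chartFun hf).isSymmSndFDerivAt (by simpa using ENat.LEInfty.out)
  have hfirst : d% f x (VectorField.mlieBracket 𝓘(ℝ, E) X Y x) = _ :=
    (mvfderiv_apply_eventuallyEq hf (VectorField.mlieBracket 𝓘(ℝ, E) X Y)).self_of_nhds
  rw [mvfderiv_mvfderiv_apply hf hY, mvfderiv_mvfderiv_apply hf hX, hfirst, Function.comp_apply,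
    chartField_mlieBracket, VectorField.lieBracket, map_sub,
    hsymm.eq (chartField x X _) (chartField x Y _)]
  abel

end LieBracket

end Calculus

variable {E : Type*} [NormedAddCommGroup E] [NormedSpace ℝ E]
  {F : Type*} [NormedAddCommGroup F] [NormedSpace ℝ F]
  {M : Type*} [TopologicalSpace M] [ChartedSpace E M]
  {N : Type*} [TopologicalSpace N] [ChartedSpace F N]
  [IsManifold 𝓘(ℝ, F) ∞ N]

/-! ### Vector fields along maps and connection forms -/

section Coordinates

/-- The vector field `V` along `ι : M → N`, as a map into the tangent bundle of `N`. -/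
abbrev fieldAlong (ι : M → N) (V : Π y : M, TangentSpace 𝓘(ℝ, F) (ι y)) :
    M → TangentBundle 𝓘(ℝ, F) N :=
  fun y ↦ ⟨ι y, V y⟩

/-- The coordinates of tangent vectors in the trivialization of the tangent bundle around `q₀`;
zero outside the chart domain. -/
def coord (q₀ q : N) : TangentSpace 𝓘(ℝ, F) q →L[ℝ] F :=
  (trivializationAt F (TangentSpace 𝓘(ℝ, F) : N → Type _) q₀).continuousLinearMapAt ℝ q

/-- The tangent vector with given coordinates in the trivialization around `q₀`; zero outside the
chart domain. -/
def coordSymm (q₀ q : N) : F →L[ℝ] TangentSpace 𝓘(ℝ, F) q :=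
  (trivializationAt F (TangentSpace 𝓘(ℝ, F) : N → Type _) q₀).symmL ℝ q

theorem trivializationAt_snd {q₀ q : N} (hq : q ∈ (chartAt F q₀).source)
    (v : TangentSpace 𝓘(ℝ, F) q) :
    (trivializationAt F (TangentSpace 𝓘(ℝ, F) : N → Type _) q₀ ⟨q, v⟩).2 = coord q₀ q v := by
  rw [coord, Trivialization.continuousLinearMapAt_apply, Trivialization.coe_linearMapAt_of_mem _ hq]

theorem trivializationAt_symm {q₀ q : N} (hq : q ∈ (chartAt F q₀).source) (z : F) :
    (trivializationAt F (TangentSpace 𝓘(ℝ, F) : N → Type _) q₀).symm q z = coordSymm q₀ q z := by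
  rw [coordSymm, Trivialization.symmL_apply _ hq]

theorem coord_coordSymm {q₀ q : N} (hq : q ∈ (chartAt F q₀).source) (z : F) :
    coord q₀ q (coordSymm q₀ q z) = z :=
  Trivialization.continuousLinearMapAt_symmL _ hq z

theorem coordSymm_coord {q₀ q : N} (hq : q ∈ (chartAt F q₀).source) (v : TangentSpace 𝓘(ℝ, F) q) :
    coordSymm q₀ q (coord q₀ q v) = v :=
  Trivialization.symmL_continuousLinearMapAt _ hq v

theorem coord_injective {q₀ q : N} (hq : q ∈ (chartAt F q₀).source) :
    Function.Injective (coord q₀ q : TangentSpace 𝓘(ℝ, F) q →L[ℝ] F) :=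
  Function.LeftInverse.injective (coordSymm_coord hq)

theorem coord_eq_mfderiv {q₀ q : N} (hq : q ∈ (chartAt F q₀).source) :
    coord q₀ q = mfderiv% (extChartAt 𝓘(ℝ, F) q₀) q :=
  TangentBundle.continuousLinearMapAt_trivializationAt hq

theorem contMDiffAt_fieldAlong_iff {ι : M → N} {q₀ : N} {x : M}
    {V : Π y : M, TangentSpace 𝓘(ℝ, F) (ι y)}
    (hx : ι x ∈ (chartAt F q₀).source) (hι : CMDiffAt ∞ ι x) :
    CMDiffAt ∞ (fieldAlong ι V) x ↔ CMDiffAt ∞ (fun y ↦ coord q₀ (ι y) (V y)) x := by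
  rw [(trivializationAt F (TangentSpace 𝓘(ℝ, F) : N → Type _) q₀).contMDiffAt_iff
    (by simpa using hx)]
  refine (and_iff_right hι).trans (Filter.EventuallyEq.contMDiffAt_iff ?_)
  filter_upwards [hι.continuousAt.eventually ((chartAt F q₀).open_source.mem_nhds hx)] with y hy
  exact trivializationAt_snd hy _

theorem mdifferentiableAt_fieldAlong_iff {ι : M → N} {q₀ : N} {x : M}
    {V : Π y : M, TangentSpace 𝓘(ℝ, F) (ι y)}
    (hx : ι x ∈ (chartAt F q₀).source) (hι : MDiffAt ι x) :
    MDiffAt (fieldAlong ι V) x ↔ MDiffAt (fun y ↦ coord q₀ (ι y) (V y)) x := by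
  rw [(trivializationAt F (TangentSpace 𝓘(ℝ, F) : N → Type _) q₀).mdifferentiableAt_totalSpace_iff
    𝓘(ℝ, F) _ (by simpa using hx)]
  refine (and_iff_right hι).trans (Filter.EventuallyEq.mdifferentiableAt_iff ?_)
  filter_upwards [hι.continuousAt.eventually ((chartAt F q₀).open_source.mem_nhds hx)] with y hy
  exact trivializationAt_snd hy _

theorem contMDiffAt_coordSymm_const {q₀ q : N} (hq : q ∈ (chartAt F q₀).source) (z : F) :
    CMDiffAt ∞ (T% (fun p : N ↦ coordSymm q₀ p z)) q := by
  refine (contMDiffAt_fieldAlong_iff (ι := fun p : N ↦ p) hq contMDiffAt_id).2 ?_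
  refine (contMDiffAt_const (c := z)).congr_of_eventuallyEq ?_
  filter_upwards [(chartAt F q₀).open_source.mem_nhds hq] with p hp using coord_coordSymm hp z

theorem exists_isSmoothField_eventually_eq_coordSymm [FiniteDimensional ℝ F] [T2Space N]
    (q₀ : N) (z : F) :
    ∃ Z : Π q : N, TangentSpace 𝓘(ℝ, F) q, IsSmoothField Z ∧
      ∀ᶠ q in 𝓝 q₀, Z q = coordSymm q₀ q z := by
  obtain ⟨f⟩ := (inferInstance : Nonempty (SmoothBumpFunction 𝓘(ℝ, F) q₀))
  refine ⟨(f : N → ℝ) • fun q ↦ coordSymm q₀ q z, ?_, ?_⟩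
  · exact ContMDiffOn.smul_section_of_tsupport f.contMDiff.contMDiffOn (chartAt F q₀).open_source
      f.tsupport_subset_chartAt_source
      fun q hq ↦ (contMDiffAt_coordSymm_const hq z).contMDiffWithinAt
  · filter_upwards [f.eventuallyEq_one] with q hq
    simp [hq]

theorem exists_isSmoothField_apply_eq [FiniteDimensional ℝ F] [T2Space N] (q₀ : N)
    (v : TangentSpace 𝓘(ℝ, F) q₀) :
    ∃ Z : Π q : N, TangentSpace 𝓘(ℝ, F) q, IsSmoothField Z ∧ Z q₀ = v := by
  obtain ⟨Z, hZ, h⟩ := exists_isSmoothField_eventually_eq_coordSymm q₀ (coord q₀ q₀ v)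
  exact ⟨Z, hZ, h.self_of_nhds.trans (coordSymm_coord (mem_chart_source F q₀) v)⟩

end Coordinates

section ConnectionForm

/-- `Γ` is the connection form of `nabla` near `q₀`: in the trivialization around `q₀` one has
`∇_u V = dV(u) + Γ(V)(u)`. -/
structure IsConnectionForm
    (nabla : CovariantDerivative 𝓘(ℝ, F) F (TangentSpace 𝓘(ℝ, F) : N → Type _)) (q₀ : N)
    (Γ : N → F →L[ℝ] F →L[ℝ] F) : Prop where
  contMDiffAt : CMDiffAt ∞ Γ q₀
  eventually : ∀ᶠ q in 𝓝 q₀, ∀ V : Π p : N, TangentSpace 𝓘(ℝ, F) p, MDiffAt (T% V) q →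
    ∀ u : TangentSpace 𝓘(ℝ, F) q, coord q₀ q (nabla V q u) =
      d% (fun p ↦ coord q₀ p (V p)) q u + Γ q (coord q₀ q (V q)) (coord q₀ q u)

variable {nabla : CovariantDerivative 𝓘(ℝ, F) F (TangentSpace 𝓘(ℝ, F) : N → Type _)}

theorem covariantDerivative_sum {κ : Type*} {s : Finset κ}
    {W : κ → Π q : N, TangentSpace 𝓘(ℝ, F) q} {q : N} (hW : ∀ i, MDiffAt (T% (W i)) q) :
    nabla (fun p ↦ ∑ i ∈ s, W i p) q = ∑ i ∈ s, nabla (W i) q := by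
  classical
  induction s using Finset.induction_on with
  | empty => exact congrFun nabla.zero q
  | insert i s hi ih =>
    simp only [Finset.sum_insert hi]
    rw [← ih]
    exact nabla.isCovariantDerivativeOnUniv.add (hW i) (.sum_section fun j _ ↦ hW j)

section Frame

variable {κ : Type*} [Fintype κ] (b : Module.Basis κ ℝ F) {q₀ : N}
  {Z : κ → Π q : N, TangentSpace 𝓘(ℝ, F) q}

theorem eventually_eq_sum_coord_smul {q : N} (hq : q ∈ (chartAt F q₀).source)
    (hZ : ∀ i, ∀ᶠ p in 𝓝 q, Z i p = coordSymm q₀ p (b i)) (V : Π q : N, TangentSpace 𝓘(ℝ, F) q) :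
    ∀ᶠ p in 𝓝 q, V p = ∑ i, b.coord i (coord q₀ p (V p)) • Z i p := by
  filter_upwards [Filter.eventually_all.2 hZ, (chartAt F q₀).open_source.mem_nhds hq] with p hp hps
  apply coord_injective hps
  simp only [hp, map_sum, map_smul, coord_coordSymm hps]
  exact (b.sum_repr _).symm

variable [FiniteDimensional ℝ F]

/-- The connection form of `nabla` near `q₀`, computed from vector fields `Z i` which near `q₀` have
the basis vectors `b i` as constant coordinates. -/
def frameConnectionForm
    (nabla : CovariantDerivative 𝓘(ℝ, F) F (TangentSpace 𝓘(ℝ, F) : N → Type _)) (q₀ : N)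
    (Z : κ → Π q : N, TangentSpace 𝓘(ℝ, F) q) (q : N) : F →L[ℝ] F →L[ℝ] F :=
  ∑ i, (LinearMap.toContinuousLinearMap (b.coord i)).smulRight
    (coord q₀ q ∘L nabla (Z i) q ∘L coordSymm q₀ q)

theorem contMDiffAt_frameConnectionForm (hnabla : nabla.ContMDiffCovariantDerivative ∞)
    (hZ : ∀ i, IsSmoothField (Z i)) : CMDiffAt ∞ (frameConnectionForm b nabla q₀ Z) q₀ := by
  refine contMDiffAt_finsetSum fun i _ ↦ contMDiffAt_smulRight _ ?_
  have h := (hnabla.contMDiff.contMDiff (σ := Z i) (hZ i).contMDiffOn).contMDiffAt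
    (x := q₀) Filter.univ_mem
  exact ((contMDiffAt_hom_bundle _).1 h).2

theorem coord_covariantDerivative_of_frame (hZs : ∀ i, IsSmoothField (Z i)) {q : N}
    (hq : q ∈ (chartAt F q₀).source) (hZ : ∀ i, ∀ᶠ p in 𝓝 q, Z i p = coordSymm q₀ p (b i))
    {V : Π q : N, TangentSpace 𝓘(ℝ, F) q} (hV : MDiffAt (T% V) q) (u : TangentSpace 𝓘(ℝ, F) q) :
    coord q₀ q (nabla V q u) = d% (fun p ↦ coord q₀ p (V p)) q u +
      frameConnectionForm b nabla q₀ Z q (coord q₀ q (V q)) (coord q₀ q u) := by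
  have hv : MDiffAt (fun p ↦ coord q₀ p (V p)) q :=
    (mdifferentiableAt_fieldAlong_iff (ι := fun p : N ↦ p) hq mdifferentiableAt_id).1 hV
  let f (i) (p : N) : ℝ := b.coord i (coord q₀ p (V p))
  have hf (i) : MDiffAt (f i) q :=
    (LinearMap.toContinuousLinearMap (b.coord i)).differentiableAt.mdifferentiableAt.comp q hv
  have hdf (i) : d% (f i) q u = b.coord i (d% (fun p ↦ coord q₀ p (V p)) q u) :=
    mvfderiv_clm_comp_apply (LinearMap.toContinuousLinearMap (b.coord i)) hv u
  have hZq (i) : MDiffAt (T% (Z i)) q := (hZs i q).mdifferentiableAt (by simp)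
  have hfZ (i) : MDiffAt (T% (f i • Z i)) q := (hf i).smul_section (hZq i)
  have hsum : nabla V q u = ∑ i, (f i q • nabla (Z i) q u + d% (f i) q u • Z i q) := by
    rw [nabla.isCovariantDerivativeOnUniv.congr_of_eventuallyEq hV
      (.sum_section fun i _ ↦ hfZ i) Filter.univ_mem
      (eventually_eq_sum_coord_smul b hq hZ V)]
    refine (congrArg (· u) (covariantDerivative_sum hfZ)).trans ?_
    rw [sum_apply]
    refine Finset.sum_congr rfl fun i _ ↦ ?_
    rw [nabla.isCovariantDerivativeOnUniv.leibniz (hZq i) (hf i)]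
    rfl
  have hderiv : ∑ i, d% (f i) q u • b i = d% (fun p ↦ coord q₀ p (V p)) q u := by
    simp only [hdf]
    exact b.sum_repr _
  simp only [hsum, map_sum, map_add, map_smul, Finset.sum_add_distrib, (hZ _).self_of_nhds,
    coord_coordSymm hq, hderiv]
  rw [add_comm]
  simp [f, frameConnectionForm, coordSymm_coord hq]

end Frame

theorem exists_isConnectionForm [FiniteDimensional ℝ F] [T2Space N]
    (hnabla : nabla.ContMDiffCovariantDerivative ∞) (q₀ : N) :
    ∃ Γ, IsConnectionForm nabla q₀ Γ := by
  let b := Module.finBasis ℝ F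
  choose Z hZs hZ using fun i ↦ exists_isSmoothField_eventually_eq_coordSymm q₀ (b i)
  refine ⟨frameConnectionForm b nabla q₀ Z, contMDiffAt_frameConnectionForm b hnabla hZs, ?_⟩
  filter_upwards [Filter.eventually_all.2 fun i ↦ (hZ i).eventually_nhds,
    chart_source_mem_nhds F q₀] with q hZq hq V hV u
  exact coord_covariantDerivative_of_frame b hZs hq hZq hV u

end ConnectionForm

section CovariantDerivativeAlong

variable (F) in
/-- The transition map from the coordinates around `q₁` to those around `q₀`, at the point `p`. -/
def coordChange (q₀ q₁ p : N) : F →L[ℝ] F :=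
  (coord q₀ p : TangentSpace 𝓘(ℝ, F) p →L[ℝ] F) ∘L coordSymm q₁ p

theorem contMDiffAt_coordChange {q₀ q₁ : N} (hq : q₁ ∈ (chartAt F q₀).source) :
    CMDiffAt ∞ (coordChange F q₀ q₁) q₁ := by
  have h := contMDiffAt_coordChangeL (n := ∞) (IB := 𝓘(ℝ, F))
    (e := trivializationAt F (TangentSpace 𝓘(ℝ, F) : N → Type _) q₁)
    (e' := trivializationAt F (TangentSpace 𝓘(ℝ, F) : N → Type _) q₀)
    (x := q₁) (mem_chart_source F q₁) hq
  refine h.congr_of_eventuallyEq ?_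
  filter_upwards [(chartAt F q₀).open_source.mem_nhds hq, chart_source_mem_nhds F q₁] with p hp hp'
  ext z
  rw [coordChange, ContinuousLinearMap.comp_apply, ← trivializationAt_snd hp,
    ← trivializationAt_symm hp']
  exact (Trivialization.coordChangeL_apply _ _ ⟨hp', hp⟩ z).symm

theorem mvfderiv_coord_comp {ι : M → N} {q₀ : N} {y : M} (hy : ι y ∈ (chartAt F q₀).source)
    (hι : MDiffAt ι y) {V : Π z : M, TangentSpace 𝓘(ℝ, F) (ι z)} (hV : MDiffAt (fieldAlong ι V) y)
    (u : TangentSpace 𝓘(ℝ, E) y) :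
    d% (fun z ↦ coord q₀ (ι z) (V z)) y u =
      d% (coordChange F q₀ (ι y)) (ι y) (mfderiv% ι y u) (coord (ι y) (ι y) (V y)) +
        coordChange F q₀ (ι y) (ι y) (d% (fun z ↦ coord (ι y) (ι z) (V z)) y u) := by
  have hT : MDiffAt (coordChange F q₀ (ι y)) (ι y) :=
    (contMDiffAt_coordChange hy).mdifferentiableAt (by simp)
  have hc : MDiffAt (fun z ↦ coord (ι y) (ι z) (V z)) y :=
    (mdifferentiableAt_fieldAlong_iff (mem_chart_source F (ι y)) hι).1 hV
  have hcoord : (fun z ↦ coord q₀ (ι z) (V z)) =ᶠ[𝓝 y]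
      fun z ↦ coordChange F q₀ (ι y) (ι z) (coord (ι y) (ι z) (V z)) := by
    filter_upwards [hι.continuousAt.eventually (chart_source_mem_nhds F (ι y))] with z hz
    rw [coordChange, ContinuousLinearMap.comp_apply, coordSymm_coord hz]
  rw [mvfderiv_congr_of_eventuallyEq hcoord, ← mvfderiv_comp_mfderiv_apply hT hι]
  exact mvfderiv_clm_apply (hT.comp y hι) hc u

variable {nabla : CovariantDerivative 𝓘(ℝ, F) F (TangentSpace 𝓘(ℝ, F) : N → Type _)}

theorem covAlong_eq {ι : M → N} {y : M} (hι : ContinuousAt ι y)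
    (V : Π z : M, TangentSpace 𝓘(ℝ, F) (ι z)) (u : TangentSpace 𝓘(ℝ, E) y) :
    covAlong nabla ι V y u =
      coordSymm (ι y) (ι y) (d% (fun z ↦ coord (ι y) (ι z) (V z)) y u) +
        nabla (fun p ↦ coordSymm (ι y) p (coord (ι y) (ι y) (V y))) (ι y) (mfderiv% ι y u) := by
  have hself := mem_chart_source F (ι y)
  have hcoord : (fun z ↦ (trivializationAt F (TangentSpace 𝓘(ℝ, F) : N → Type _) (ι y)
      (fieldAlong ι V z)).2) =ᶠ[𝓝 y] fun z ↦ coord (ι y) (ι z) (V z) := by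
    filter_upwards [hι.eventually (chart_source_mem_nhds F (ι y))] with z hz
      using trivializationAt_snd hz _
  have hconst : ∀ᶠ p in 𝓝 (ι y), coordSymm (ι y) p (coord (ι y) (ι y) (V y)) =
      (trivializationAt F (TangentSpace 𝓘(ℝ, F) : N → Type _) (ι y)).symm p
        (trivializationAt F (TangentSpace 𝓘(ℝ, F) : N → Type _) (ι y) (fieldAlong ι V y)).2 := by
    rw [hcoord.eq_of_nhds]
    filter_upwards [chart_source_mem_nhds F (ι y)] with p hp using (trivializationAt_symm hp _).symm
  have hsmooth := (contMDiffAt_coordSymm_const hself (coord (ι y) (ι y) (V y))).mdifferentiableAt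
    (by simp)
  have hdiff := hsmooth.congr_of_eventuallyEq
    (hconst.mono fun p hp ↦ congrArg (TotalSpace.mk' F p) hp.symm)
  rw [nabla.isCovariantDerivativeOnUniv.congr_of_eventuallyEq hsmooth hdiff Filter.univ_mem hconst,
    ← trivializationAt_symm hself, ← mvfderiv_congr_of_eventuallyEq hcoord]
  rfl

theorem IsConnectionForm.coord_covAlong {ι : M → N} (hι : CMDiff ∞ ι) {x : M}
    {Γ : N → F →L[ℝ] F →L[ℝ] F} (hΓ : IsConnectionForm nabla (ι x) Γ) :
    ∀ᶠ y in 𝓝 x, ∀ V : Π z : M, TangentSpace 𝓘(ℝ, F) (ι z), MDiffAt (fieldAlong ι V) y →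
      ∀ u : TangentSpace 𝓘(ℝ, E) y, coord (ι x) (ι y) (covAlong nabla ι V y u) =
        d% (fun z ↦ coord (ι x) (ι z) (V z)) y u +
          Γ (ι y) (coord (ι x) (ι y) (V y)) (coord (ι x) (ι y) (mfderiv% ι y u)) := by
  have hιc := hι.continuous.continuousAt (x := x)
  filter_upwards [hιc.eventually hΓ.eventually, hιc.eventually (chart_source_mem_nhds F (ι x))]
    with y hΓy hy V hV u
  have hιy : MDiffAt ι y := (hι y).mdifferentiableAt (by simp)
  have hself := mem_chart_source F (ι y)
  set c := coord (ι y) (ι y) (V y) with hc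
  have hconst := (contMDiffAt_coordSymm_const hself c).mdifferentiableAt (by simp)
  have hchange : d% (fun p ↦ coord (ι x) p (coordSymm (ι y) p c)) (ι y) (mfderiv% ι y u) =
      d% (coordChange F (ι x) (ι y)) (ι y) (mfderiv% ι y u) c :=
    mvfderiv_clm_comp_apply (ContinuousLinearMap.apply ℝ F c)
      ((contMDiffAt_coordChange hy).mdifferentiableAt (by simp)) _
  rw [covAlong_eq hιy.continuousAt, map_add, hΓy _ hconst, hchange,
    mvfderiv_coord_comp hy hιy hV, ← hc]
  simp only [hc, coordSymm_coord hself, coordChange, ContinuousLinearMap.comp_apply]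
  abel

end CovariantDerivativeAlong

section CurvatureAlong

/-- The curvature `R(u, v)w` at `q` of a connection with connection form `Γ` near `q`. -/
def curvatureOfForm (Γ : N → F →L[ℝ] F →L[ℝ] F) (q : N) (u v w : TangentSpace 𝓘(ℝ, F) q) :
    TangentSpace 𝓘(ℝ, F) q :=
  coordSymm q q <|
    d% Γ q u (coord q q w) (coord q q v) - d% Γ q v (coord q q w) (coord q q u) +
      Γ q (Γ q (coord q q w) (coord q q v)) (coord q q u) -
      Γ q (Γ q (coord q q w) (coord q q u)) (coord q q v)

variable [IsManifold 𝓘(ℝ, E) ∞ M] {ι : M → N} {x : M}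

theorem contMDiffAt_coord_mfderiv (hι : CMDiffAt ∞ ι x) {X : Π y : M, TangentSpace 𝓘(ℝ, E) y}
    (hX : CMDiffAt ∞ (T% X) x) :
    CMDiffAt ∞ (fun y ↦ coord (ι x) (ι y) (mfderiv% ι y (X y))) x :=
  (contMDiffAt_fieldAlong_iff (mem_chart_source F (ι x)) hι).1 (contMDiffAt_mfderiv_apply hι hX)

theorem coord_mfderiv_mlieBracket [CompleteSpace E] (hι : CMDiff ∞ ι)
    {X Y : Π y : M, TangentSpace 𝓘(ℝ, E) y} (hX : CMDiffAt ∞ (T% X) x)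
    (hY : CMDiffAt ∞ (T% Y) x) :
    coord (ι x) (ι x) (mfderiv% ι x (VectorField.mlieBracket 𝓘(ℝ, E) X Y x)) =
      d% (fun y ↦ coord (ι x) (ι y) (mfderiv% ι y (Y y))) x (X x) -
        d% (fun y ↦ coord (ι x) (ι y) (mfderiv% ι y (X y))) x (Y x) := by
  have hf : CMDiffAt ∞ (fun y ↦ extChartAt 𝓘(ℝ, F) (ι x) (ι y)) x :=
    contMDiffAt_extChartAt.comp x (hι x)
  have hcoord : ∀ᶠ y in 𝓝 x, ∀ u : TangentSpace 𝓘(ℝ, E) y,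
      coord (ι x) (ι y) (mfderiv% ι y u) =
        d% (fun y ↦ extChartAt 𝓘(ℝ, F) (ι x) (ι y)) y u := by
    filter_upwards [hι.continuous.continuousAt.eventually (chart_source_mem_nhds F (ι x))]
      with y hy u
    rw [coord_eq_mfderiv hy]
    exact (mvfderiv_comp_mfderiv_apply (mdifferentiableAt_extChartAt hy)
      ((hι y).mdifferentiableAt (by simp)) u).symm
  rw [hcoord.self_of_nhds, mvfderiv_mlieBracket hf hX hY,
    mvfderiv_congr_of_eventuallyEq (hcoord.mono fun y hy ↦ hy (Y y)),
    mvfderiv_congr_of_eventuallyEq (hcoord.mono fun y hy ↦ hy (X y))]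

variable {nabla : CovariantDerivative 𝓘(ℝ, F) F (TangentSpace 𝓘(ℝ, F) : N → Type _)}
  {Γ : N → F →L[ℝ] F →L[ℝ] F} {V : Π z : M, TangentSpace 𝓘(ℝ, F) (ι z)}

namespace IsConnectionForm

theorem eventually_coord_covAlong (hΓ : IsConnectionForm nabla (ι x) Γ) (hι : CMDiff ∞ ι)
    (hV : CMDiffAt ∞ (fieldAlong ι V) x) (W : Π y : M, TangentSpace 𝓘(ℝ, E) y) :
    ∀ᶠ y in 𝓝 x, coord (ι x) (ι y) (covAlong nabla ι V y (W y)) =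
      d% (fun z ↦ coord (ι x) (ι z) (V z)) y (W y) +
        Γ (ι y) (coord (ι x) (ι y) (V y)) (coord (ι x) (ι y) (mfderiv% ι y (W y))) := by
  have hV1 := (contMDiffAt_iff_contMDiffAt_nhds (n := 1) (by simp)).1
    (hV.of_le (by exact_mod_cast le_top))
  filter_upwards [hΓ.coord_covAlong hι, hV1] with y hy hVy
  exact hy V (hVy.mdifferentiableAt one_ne_zero) (W y)

theorem contMDiffAt_covAlong (hΓ : IsConnectionForm nabla (ι x) Γ) (hι : CMDiff ∞ ι)
    (hV : CMDiffAt ∞ (fieldAlong ι V) x) {X : Π y : M, TangentSpace 𝓘(ℝ, E) y}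
    (hX : CMDiffAt ∞ (T% X) x) :
    CMDiffAt ∞ (fieldAlong ι fun z ↦ covAlong nabla ι V z (X z)) x := by
  refine (contMDiffAt_fieldAlong_iff (mem_chart_source F (ι x)) (hι x)).2 ?_
  have hv := (contMDiffAt_fieldAlong_iff (mem_chart_source F (ι x)) (hι x)).1 hV
  refine ContMDiffAt.congr_of_eventuallyEq ?_ (hΓ.eventually_coord_covAlong hι hV X)
  exact (contMDiffAt_mvfderiv_apply hv hX).add
    (((hΓ.contMDiffAt.comp x (hι x)).clm_apply hv).clm_apply (contMDiffAt_coord_mfderiv (hι x) hX))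

theorem coord_covAlong_covAlong (hΓ : IsConnectionForm nabla (ι x) Γ) (hι : CMDiff ∞ ι)
    (hV : CMDiffAt ∞ (fieldAlong ι V) x) {W : Π y : M, TangentSpace 𝓘(ℝ, E) y}
    (hW : CMDiffAt ∞ (T% W) x) (W' : Π y : M, TangentSpace 𝓘(ℝ, E) y) {v a a' : M → F}
    (hv : v = fun y ↦ coord (ι x) (ι y) (V y))
    (ha : a = fun y ↦ coord (ι x) (ι y) (mfderiv% ι y (W y)))
    (ha' : a' = fun y ↦ coord (ι x) (ι y) (mfderiv% ι y (W' y))) :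
    coord (ι x) (ι x) (covAlong nabla ι (fun y ↦ covAlong nabla ι V y (W y)) x (W' x)) =
      d% (fun y ↦ d% v y (W y)) x (W' x) +
        (d% Γ (ι x) (mfderiv% ι x (W' x)) (v x) (a x) + Γ (ι x) (d% v x (W' x)) (a x) +
          Γ (ι x) (v x) (d% a x (W' x))) +
        (Γ (ι x) (d% v x (W x)) (a' x) + Γ (ι x) (Γ (ι x) (v x) (a x)) (a' x)) := by
  have hιx : MDiffAt ι x := (hι x).mdifferentiableAt (by simp)
  have hΓx : MDiffAt Γ (ι x) := hΓ.contMDiffAt.mdifferentiableAt (by simp)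
  have hΓι : MDiffAt (fun y ↦ Γ (ι y)) x := hΓx.comp x hιx
  have hvs : CMDiffAt ∞ v x :=
    hv ▸ (contMDiffAt_fieldAlong_iff (mem_chart_source F (ι x)) (hι x)).1 hV
  have has : CMDiffAt ∞ a x := ha ▸ contMDiffAt_coord_mfderiv (hι x) hW
  have hvd : MDiffAt v x := hvs.mdifferentiableAt (by simp)
  have had : MDiffAt a x := has.mdifferentiableAt (by simp)
  have hdv : MDiffAt (fun y ↦ d% v y (W y)) x :=
    (contMDiffAt_mvfderiv_apply hvs hW).mdifferentiableAt (by simp)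
  have hfirst : (fun y ↦ coord (ι x) (ι y) (covAlong nabla ι V y (W y))) =ᶠ[𝓝 x]
      fun y ↦ d% v y (W y) + Γ (ι y) (v y) (a y) := by
    subst hv ha
    exact hΓ.eventually_coord_covAlong hι hV W
  have hfirstx : coord (ι x) (ι x) (covAlong nabla ι V x (W x)) =
      d% v x (W x) + Γ (ι x) (v x) (a x) := hfirst.self_of_nhds
  rw [(hΓ.eventually_coord_covAlong hι (hΓ.contMDiffAt_covAlong hι hV hW) W').self_of_nhds,
    mvfderiv_congr_of_eventuallyEq hfirst, hfirstx,
    mvfderiv_fun_add hdv ((hΓι.clm_apply hvd).clm_apply had), add_apply,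
    mvfderiv_clm_apply_apply hΓι hvd had, mvfderiv_comp_mfderiv_apply hΓx hιx, map_add,
    ← congrFun ha' x]
  rfl

theorem curvature_along [CompleteSpace E] (hΓ : IsConnectionForm nabla (ι x) Γ)
    (hι : CMDiff ∞ ι) (hV : CMDiffAt ∞ (fieldAlong ι V) x)
    {X Y : Π y : M, TangentSpace 𝓘(ℝ, E) y} (hX : CMDiffAt ∞ (T% X) x)
    (hY : CMDiffAt ∞ (T% Y) x) :
    covAlong nabla ι (fun y ↦ covAlong nabla ι V y (Y y)) x (X x) -
        covAlong nabla ι (fun y ↦ covAlong nabla ι V y (X y)) x (Y x) -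
        covAlong nabla ι V x (VectorField.mlieBracket 𝓘(ℝ, E) X Y x) =
      curvatureOfForm Γ (ι x) (mfderiv% ι x (X x)) (mfderiv% ι x (Y x)) (V x) := by
  have hself := mem_chart_source F (ι x)
  have hv := (contMDiffAt_fieldAlong_iff hself (hι x)).1 hV
  have hbracket := (hΓ.eventually_coord_covAlong hι hV
    (VectorField.mlieBracket 𝓘(ℝ, E) X Y)).self_of_nhds
  apply coord_injective hself
  rw [curvatureOfForm, coord_coordSymm hself, map_sub, map_sub, hbracket,
    hΓ.coord_covAlong_covAlong hι hV hX Y rfl rfl rfl,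
    hΓ.coord_covAlong_covAlong hι hV hY X rfl rfl rfl,
    coord_mfderiv_mlieBracket hι hX hY, mvfderiv_mlieBracket hv hX hY, map_sub]
  abel

end IsConnectionForm

end CurvatureAlong

/-! ### Algebraic curvature tensors -/

section Algebra

variable {T : Type*} [AddCommGroup T] [Module ℝ T]

/-- `K` is an algebraic curvature tensor on `T`. Linearity is required in the first slot only, the
other slots following from the symmetries. -/
structure IsAlgebraicCurvatureTensor (K : T → T → T → T → ℝ) : Prop where
  add_left (u u' v w z : T) : K (u + u') v w z = K u v w z + K u' v w z
  smul_left (a : ℝ) (u v w z : T) : K (a • u) v w z = a * K u v w z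
  skew_left (u v w z : T) : K u v w z = -K v u w z
  skew_right (u v w z : T) : K u v w z = -K u v z w
  bianchi (u v w z : T) : K u v w z + K v w u z + K w u v z = 0

namespace IsAlgebraicCurvatureTensor

variable {K L : T → T → T → T → ℝ}

theorem sub_const_mul (hK : IsAlgebraicCurvatureTensor K) (hL : IsAlgebraicCurvatureTensor L)
    (c : ℝ) : IsAlgebraicCurvatureTensor fun u v w z ↦ K u v w z - c * L u v w z where
  add_left u u' v w z := by rw [hK.add_left, hL.add_left]; ring
  smul_left a u v w z := by rw [hK.smul_left, hL.smul_left]; ring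
  skew_left u v w z := by rw [hK.skew_left, hL.skew_left]; ring
  skew_right u v w z := by rw [hK.skew_right, hL.skew_right]; ring
  bianchi u v w z := by linear_combination hK.bianchi u v w z - c * hL.bianchi u v w z

theorem pair_symm (hK : IsAlgebraicCurvatureTensor K) (u v w z : T) :
    K u v w z = K w z u v := by
  linarith [hK.bianchi u v w z, hK.bianchi v w z u, hK.bianchi w z u v, hK.bianchi z u v w,
    hK.skew_right u v z w, hK.skew_right w z v u, hK.skew_right v w z u, hK.skew_right z u v w,
    hK.skew_left u w z v, hK.skew_right w u z v, hK.skew_left v z u w, hK.skew_right z v u w]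

theorem add₂ (hK : IsAlgebraicCurvatureTensor K) (u v v' w z : T) :
    K u (v + v') w z = K u v w z + K u v' w z := by
  rw [hK.skew_left, hK.add_left, hK.skew_left v, hK.skew_left v']
  ring

theorem add₃ (hK : IsAlgebraicCurvatureTensor K) (u v w w' z : T) :
    K u v (w + w') z = K u v w z + K u v w' z := by
  rw [hK.pair_symm, hK.add_left, hK.pair_symm w, hK.pair_symm w']

theorem add₄ (hK : IsAlgebraicCurvatureTensor K) (u v w z z' : T) :
    K u v w (z + z') = K u v w z + K u v w z' := by
  rw [hK.pair_symm, hK.add₂, hK.pair_symm u v w z, hK.pair_symm u v w z']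

theorem smul₂ (hK : IsAlgebraicCurvatureTensor K) (a : ℝ) (u v w z : T) :
    K u (a • v) w z = a * K u v w z := by
  rw [hK.skew_left, hK.smul_left, hK.skew_left v]
  ring

theorem smul₃ (hK : IsAlgebraicCurvatureTensor K) (a : ℝ) (u v w z : T) :
    K u v (a • w) z = a * K u v w z := by
  rw [hK.pair_symm, hK.smul_left, hK.pair_symm w]

theorem smul₄ (hK : IsAlgebraicCurvatureTensor K) (a : ℝ) (u v w z : T) :
    K u v w (a • z) = a * K u v w z := by
  rw [hK.pair_symm, hK.smul₂, hK.pair_symm u v w z]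

theorem eq_zero_of_sectional_eq_zero (hK : IsAlgebraicCurvatureTensor K)
    (hzero : ∀ u v, K u v v u = 0) (u v w z : T) : K u v w z = 0 := by
  have hdiag (u v z : T) : K u v v z = 0 := by
    have hpolar := hzero (u + z) v
    rw [hK.add_left, hK.add₄, hK.add₄, hzero, hzero] at hpolar
    have hswap : K z v v u = K u v v z := by rw [hK.pair_symm, hK.skew_left, hK.skew_right, neg_neg]
    linarith
  have hskew (u v w z : T) : K u v w z = -K u w v z := by
    have hpolar := hdiag u (v + w) z
    rw [hK.add₂, hK.add₃, hK.add₃, hdiag, hdiag] at hpolar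
    linarith
  -- `K` is alternating in its first three arguments, so the Bianchi sum is `3 * K u v w z`
  linarith [hK.bianchi u v w z, hskew u v w z, hK.skew_left w u v z, hK.skew_left v w u z,
    hskew w v u z, hskew v u w z, hK.skew_left v u w z]

theorem continuous_sectional_line (hK : IsAlgebraicCurvatureTensor K) (u v u' v' : T) :
    Continuous fun t : ℝ ↦ K (u + t • u') (v + t • v') (v + t • v') (u + t • u') := by
  simp only [hK.add_left, hK.add₂, hK.add₃, hK.add₄, hK.smul_left, hK.smul₂, hK.smul₃, hK.smul₄]
  fun_prop

end IsAlgebraicCurvatureTensor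

/-- The Gram determinant of `u` and `v`; it is nonzero iff `u` and `v` span a nondegenerate
plane. -/
def gramDet (B : LinearMap.BilinForm ℝ T) (u v : T) : ℝ :=
  B u u * B v v - B u v ^ 2

theorem eventually_gramDet_line_ne_zero (B : LinearMap.BilinForm ℝ T) {u₀ v₀ : T}
    (h₀ : gramDet B u₀ v₀ ≠ 0) (u v : T) :
    ∀ᶠ t in 𝓝[≠] (0 : ℝ), gramDet B (u + t • (u₀ - u)) (v + t • (v₀ - v)) ≠ 0 := by
  have hanalytic : AnalyticOnNhd ℝ
      (fun t : ℝ ↦ gramDet B (u + t • (u₀ - u)) (v + t • (v₀ - v))) Set.univ := by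
    intro t _
    simp only [gramDet, map_add, map_smul, LinearMap.add_apply, LinearMap.smul_apply, smul_eq_mul]
    fun_prop
  refine (hanalytic 0 trivial).eventually_eq_zero_or_eventually_ne_zero.resolve_left fun h ↦ h₀ ?_
  simpa using congrFun (hanalytic.eq_of_eventuallyEq (g := 0) analyticOnNhd_const h) 1

namespace IsAlgebraicCurvatureTensor

variable {K : T → T → T → T → ℝ}

theorem sectional_eq_zero_of_nondegenerate (hK : IsAlgebraicCurvatureTensor K)
    (B : LinearMap.BilinForm ℝ T) (hzero : ∀ u v, gramDet B u v ≠ 0 → K u v v u = 0) {u₀ v₀ : T}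
    (h₀ : gramDet B u₀ v₀ ≠ 0) (u v : T) : K u v v u = 0 := by
  have hlimit : Filter.Tendsto
      (fun t : ℝ ↦ K (u + t • (u₀ - u)) (v + t • (v₀ - v)) (v + t • (v₀ - v)) (u + t • (u₀ - u)))
      (𝓝[≠] 0) (𝓝 (K u v v u)) := by
    simpa using (hK.continuous_sectional_line u v (u₀ - u) (v₀ - v)).continuousAt.tendsto.mono_left
      (nhdsWithin_le_nhds (a := (0 : ℝ)))
  exact tendsto_nhds_unique hlimit <| tendsto_const_nhds.congr' <|
    (eventually_gramDet_line_ne_zero B h₀ u v).mono fun t ht ↦ (hzero _ _ ht).symm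

theorem eq_zero_of_nondegenerate (hK : IsAlgebraicCurvatureTensor K)
    (B : LinearMap.BilinForm ℝ T) (hzero : ∀ u v, gramDet B u v ≠ 0 → K u v v u = 0) {u₀ v₀ : T}
    (h₀ : gramDet B u₀ v₀ ≠ 0) (u v w z : T) : K u v w z = 0 :=
  hK.eq_zero_of_sectional_eq_zero (hK.sectional_eq_zero_of_nondegenerate B hzero h₀) u v w z

end IsAlgebraicCurvatureTensor

theorem isAlgebraicCurvatureTensor_of_bilinForm {B : LinearMap.BilinForm ℝ T}
    (hB : ∀ u v, B u v = B v u) :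
    IsAlgebraicCurvatureTensor fun u v w z ↦ B v w * B u z - B u w * B v z where
  add_left u u' v w z := by simp only [map_add, LinearMap.add_apply]; ring
  smul_left a u v w z := by simp only [map_smul, LinearMap.smul_apply, smul_eq_mul]; ring
  skew_left u v w z := by ring
  skew_right u v w z := by ring
  bianchi u v w z := by rw [hB v u, hB w u, hB w v]; ring

end Algebra

/-! ### Spaces of constant curvature -/

theorem contMDiffAt_metric (g : SemiRiemannianMetric F N) {ι : M → N} {x : M}
    (hι : CMDiffAt ∞ ι x) {V W : Π z : M, TangentSpace 𝓘(ℝ, F) (ι z)}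
    (hV : CMDiffAt ∞ (fieldAlong ι V) x) (hW : CMDiffAt ∞ (fieldAlong ι W) x) :
    CMDiffAt ∞ (fun z ↦ g.val (ι z) (V z) (W z)) x := by
  have h := ContMDiffAt.clm_bundle_apply₂ (F₁ := F) (F₂ := F) (F₃ := ℝ)
    (E₁ := (TangentSpace 𝓘(ℝ, F) : N → Type _)) (E₂ := (TangentSpace 𝓘(ℝ, F) : N → Type _))
    (E₃ := Bundle.Trivial N ℝ) (b := ι) (ψ := fun z ↦ g.val (ι z))
    ((g.contMDiff (ι x)).comp x hι) hV hW
  exact (contMDiffAt_totalSpace.1 h).2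

section SmoothField

variable {X Y : Π q : N, TangentSpace 𝓘(ℝ, F) q}

theorem IsSmoothField.mdifferentiableAt (hX : IsSmoothField X) (q : N) : MDiffAt (T% X) q :=
  (hX q).mdifferentiableAt (by simp)

theorem IsSmoothField.mlieBracket [CompleteSpace F] (hX : IsSmoothField X) (hY : IsSmoothField Y) :
    IsSmoothField (VectorField.mlieBracket 𝓘(ℝ, F) X Y) := by
  have : IsManifold 𝓘(ℝ, F) (minSmoothness ℝ 2) N := by
    rw [minSmoothness_of_isRCLikeNormedField]
    infer_instance
  have : IsManifold 𝓘(ℝ, F) (((⊤ : ℕ∞) : ℕ∞ω) + 1) N := inferInstanceAs (IsManifold 𝓘(ℝ, F) ∞ N)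
  exact ContDiff.mlieBracket_vectorField (m := ⊤) (n := ⊤) hX hY (by simp)

end SmoothField

section Connection

/-- The curvature `R(X, Y)Z` of the covariant derivative `nabla`, as an operator on vector
fields. -/
abbrev connectionCurvature
    (nabla : CovariantDerivative 𝓘(ℝ, F) F (TangentSpace 𝓘(ℝ, F) : N → Type _))
    (X Y Z : Π q : N, TangentSpace 𝓘(ℝ, F) q) : Π q : N, TangentSpace 𝓘(ℝ, F) q :=
  curvature (fun V W p ↦ nabla W p (V p)) X Y Z

variable {nabla : CovariantDerivative 𝓘(ℝ, F) F (TangentSpace 𝓘(ℝ, F) : N → Type _)}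
  {q : N} {Γ : N → F →L[ℝ] F →L[ℝ] F} {X Y Z : Π q : N, TangentSpace 𝓘(ℝ, F) q}

theorem curvatureOfForm_add (Γ : N → F →L[ℝ] F →L[ℝ] F) (q : N)
    (u u' v w : TangentSpace 𝓘(ℝ, F) q) :
    curvatureOfForm Γ q (u + u') v w = curvatureOfForm Γ q u v w + curvatureOfForm Γ q u' v w := by
  let L : TangentSpace 𝓘(ℝ, F) q →L[ℝ] F →L[ℝ] F →L[ℝ] F := mvfderiv 𝓘(ℝ, F) Γ q
  have hL (u) : d% Γ q u = L u := rfl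
  simp only [curvatureOfForm, hL]
  rw [← map_add, L.map_add, (coord q q).map_add, (L v _).map_add, (Γ q (Γ q _ _)).map_add,
    (Γ q _).map_add, (Γ q).map_add, add_apply, add_apply, add_apply]
  abel_nf

theorem curvatureOfForm_smul (Γ : N → F →L[ℝ] F →L[ℝ] F) (q : N) (a : ℝ)
    (u v w : TangentSpace 𝓘(ℝ, F) q) :
    curvatureOfForm Γ q (a • u) v w = a • curvatureOfForm Γ q u v w := by
  let L : TangentSpace 𝓘(ℝ, F) q →L[ℝ] F →L[ℝ] F →L[ℝ] F := mvfderiv 𝓘(ℝ, F) Γ q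
  have hL (u) : d% Γ q u = L u := rfl
  simp only [curvatureOfForm, hL]
  rw [← map_smul, L.map_smul, (coord q q).map_smul, (L v _).map_smul, (Γ q (Γ q _ _)).map_smul,
    (Γ q _).map_smul, (Γ q).map_smul, smul_apply, smul_apply, smul_apply, smul_sub, smul_add,
    smul_sub]

theorem curvatureOfForm_swap (Γ : N → F →L[ℝ] F →L[ℝ] F) (q : N)
    (u v w : TangentSpace 𝓘(ℝ, F) q) :
    curvatureOfForm Γ q u v w = -curvatureOfForm Γ q v u w := by
  simp only [curvatureOfForm, ← map_neg]
  abel_nf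

theorem mfderiv_id_apply {N : Type*} [TopologicalSpace N] [ChartedSpace F N] {q : N}
    (v : TangentSpace 𝓘(ℝ, F) q) : mfderiv% (id : N → N) q v = v :=
  congrArg (fun L : F →L[ℝ] F ↦ L v) mfderiv_id

variable [FiniteDimensional ℝ F] [T2Space N] (hnabla : nabla.ContMDiffCovariantDerivative ∞)

include hnabla

theorem covAlong_id (hX : IsSmoothField X) :
    covAlong nabla (id : N → N) X = fun q v ↦ nabla X q v := by
  funext q v
  obtain ⟨Γ, hΓ⟩ := exists_isConnectionForm hnabla q
  have halong := (hΓ.coord_covAlong (ι := (id : N → N)) contMDiff_id).self_of_nhds X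
    (hX.mdifferentiableAt q) v
  rw [mfderiv_id_apply] at halong
  exact coord_injective (mem_chart_source F q)
    (halong.trans (hΓ.eventually.self_of_nhds X (hX.mdifferentiableAt q) v).symm)

theorem isSmoothField_covariantDerivative (hX : IsSmoothField X) (hY : IsSmoothField Y) :
    IsSmoothField fun p ↦ nabla Y p (X p) := by
  intro q
  obtain ⟨Γ, hΓ⟩ := exists_isConnectionForm hnabla q
  have h := hΓ.contMDiffAt_covAlong (ι := (id : N → N)) contMDiff_id (hY q) (hX q)
  rwa [covAlong_id hnabla hY] at h

theorem connectionCurvature_apply (hX : IsSmoothField X) (hY : IsSmoothField Y)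
    (hZ : IsSmoothField Z) (hΓ : IsConnectionForm nabla q Γ) :
    connectionCurvature nabla X Y Z q = curvatureOfForm Γ q (X q) (Y q) (Z q) := by
  have h := hΓ.curvature_along (ι := (id : N → N)) contMDiff_id (hZ q) (hX q) (hY q)
  rw [mfderiv_id_apply, mfderiv_id_apply, covAlong_id hnabla hZ,
    covAlong_id hnabla (isSmoothField_covariantDerivative hnabla hX hZ),
    covAlong_id hnabla (isSmoothField_covariantDerivative hnabla hY hZ)] at h
  exact h

end Connection

namespace IsLeviCivita

variable [FiniteDimensional ℝ F] {g : SemiRiemannianMetric F N}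
  {nabla : CovariantDerivative 𝓘(ℝ, F) F (TangentSpace 𝓘(ℝ, F) : N → Type _)}
  (hnabla : IsLeviCivita g nabla) {V W X Y Z : Π q : N, TangentSpace 𝓘(ℝ, F) q}

include hnabla

theorem covariantDerivative_sub_swap (hX : IsSmoothField X) (hY : IsSmoothField Y) (q : N) :
    nabla Y q (X q) - nabla X q (Y q) = VectorField.mlieBracket 𝓘(ℝ, F) X Y q :=
  nabla.torsion_eq_zero_iff.1 hnabla.torsion_free (hX.mdifferentiableAt q) (hY.mdifferentiableAt q)

variable [T2Space N]

theorem mvfderiv_mvfderiv_metric (hX : IsSmoothField X) (hZ : IsSmoothField Z)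
    (hW : IsSmoothField W) (q : N) (v : TangentSpace 𝓘(ℝ, F) q) :
    d% (fun p ↦ d% (fun p ↦ g.val p (Z p) (W p)) p (X p)) q v =
      g.val q (nabla (fun p ↦ nabla Z p (X p)) q v) (W q) +
        g.val q (nabla Z q (X q)) (nabla W q v) +
        (g.val q (nabla Z q v) (nabla W q (X q)) +
          g.val q (Z q) (nabla (fun p ↦ nabla W p (X p)) q v)) := by
  have hmetric {V W : Π q : N, TangentSpace 𝓘(ℝ, F) q} (hV : IsSmoothField V)
      (hW : IsSmoothField W) : MDiffAt (fun p ↦ g.val p (V p) (W p)) q :=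
    (contMDiffAt_metric g (ι := (id : N → N)) contMDiffAt_id (hV q) (hW q)).mdifferentiableAt
      (by simp)
  have hXZ := isSmoothField_covariantDerivative hnabla.smooth hX hZ
  have hXW := isSmoothField_covariantDerivative hnabla.smooth hX hW
  simp only [hnabla.metric Z W _ (hZ.mdifferentiableAt _) (hW.mdifferentiableAt _)]
  rw [mvfderiv_fun_add (hmetric hXZ hW) (hmetric hZ hXW), add_apply,
    hnabla.metric _ W q (hXZ.mdifferentiableAt q) (hW.mdifferentiableAt q),
    hnabla.metric Z _ q (hZ.mdifferentiableAt q) (hXW.mdifferentiableAt q)]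

theorem metric_curvature_swap (hX : IsSmoothField X) (hY : IsSmoothField Y)
    (hZ : IsSmoothField Z) (hW : IsSmoothField W) (q : N) :
    g.val q (connectionCurvature nabla X Y Z q) (W q) =
      -g.val q (connectionCurvature nabla X Y W q) (Z q) := by
  have h := mvfderiv_mlieBracket
    (contMDiffAt_metric g (ι := (id : N → N)) contMDiffAt_id (hZ q) (hW q)) (hX q) (hY q)
  simp only [id] at h
  rw [hnabla.mvfderiv_mvfderiv_metric hY hZ hW, hnabla.mvfderiv_mvfderiv_metric hX hZ hW,
    hnabla.metric Z W q (hZ.mdifferentiableAt q) (hW.mdifferentiableAt q)] at h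
  rw [g.symm q (connectionCurvature nabla X Y W q)]
  simp only [connectionCurvature, curvature, map_sub, sub_apply]
  linarith

theorem covariantDerivative_covariantDerivative_swap (hX : IsSmoothField X) (hY : IsSmoothField Y)
    (q : N) (v : TangentSpace 𝓘(ℝ, F) q) :
    nabla (fun p ↦ nabla Y p (X p)) q v =
      nabla (fun p ↦ nabla X p (Y p)) q v +
        nabla (VectorField.mlieBracket 𝓘(ℝ, F) X Y) q v := by
  have heq : (fun p ↦ nabla Y p (X p)) =
      (fun p ↦ nabla X p (Y p)) + VectorField.mlieBracket 𝓘(ℝ, F) X Y :=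
    funext fun p ↦ sub_eq_iff_eq_add'.1 (hnabla.covariantDerivative_sub_swap hX hY p)
  have hYX := isSmoothField_covariantDerivative hnabla.smooth hY hX
  rw [heq, nabla.isCovariantDerivativeOnUniv.add (hYX.mdifferentiableAt q)
    ((hX.mlieBracket hY).mdifferentiableAt q), add_apply]

theorem curvature_bianchi (hX : IsSmoothField X) (hY : IsSmoothField Y) (hZ : IsSmoothField Z)
    (q : N) :
    connectionCurvature nabla X Y Z q + connectionCurvature nabla Y Z X q +
      connectionCurvature nabla Z X Y q = 0 := by
  have : IsManifold 𝓘(ℝ, F) (minSmoothness ℝ 3) N := by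
    rw [minSmoothness_of_isRCLikeNormedField]
    infer_instance
  have hle : minSmoothness ℝ 2 ≤ (∞ : ℕ∞ω) := by
    rw [minSmoothness_of_isRCLikeNormedField]
    exact ENat.LEInfty.out
  have hjacobi := VectorField.leibniz_identity_mlieBracket_apply (I := 𝓘(ℝ, F)) (x := q)
    ((hX q).of_le hle) ((hY q).of_le hle) ((hZ q).of_le hle)
  rw [VectorField.mlieBracket_swap_apply (V := VectorField.mlieBracket 𝓘(ℝ, F) X Y),
    ← hnabla.covariantDerivative_sub_swap hX (hY.mlieBracket hZ),
    ← hnabla.covariantDerivative_sub_swap hZ (hX.mlieBracket hY),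
    ← hnabla.covariantDerivative_sub_swap hY (hX.mlieBracket hZ)] at hjacobi
  have hneg : nabla Y q (VectorField.mlieBracket 𝓘(ℝ, F) Z X q) =
      -nabla Y q (VectorField.mlieBracket 𝓘(ℝ, F) X Z q) := by
    rw [VectorField.mlieBracket_swap_apply, map_neg]
  simp only [connectionCurvature, curvature]
  rw [hnabla.covariantDerivative_covariantDerivative_swap hY hZ,
    hnabla.covariantDerivative_covariantDerivative_swap hX hZ,
    hnabla.covariantDerivative_covariantDerivative_swap hX hY, hneg]
  exact Eq.trans (by abel) (sub_eq_zero.2 hjacobi)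

end IsLeviCivita

section ConstantCurvature

variable [FiniteDimensional ℝ F] [T2Space N] {g : SemiRiemannianMetric F N}
  {nabla : CovariantDerivative 𝓘(ℝ, F) F (TangentSpace 𝓘(ℝ, F) : N → Type _)}
  {q : N} {Γ : N → F →L[ℝ] F →L[ℝ] F}

theorem IsLeviCivita.isAlgebraicCurvatureTensor (hnabla : IsLeviCivita g nabla)
    (hΓ : IsConnectionForm nabla q Γ) :
    IsAlgebraicCurvatureTensor fun u v w z ↦ g.val q (curvatureOfForm Γ q u v w) z where
  add_left u u' v w z := by rw [curvatureOfForm_add, map_add, add_apply]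
  smul_left a u v w z := by rw [curvatureOfForm_smul, map_smul, smul_apply, smul_eq_mul]
  skew_left u v w z := by rw [curvatureOfForm_swap, map_neg, neg_apply]
  skew_right u v w z := by
    obtain ⟨X, hX, rfl⟩ := exists_isSmoothField_apply_eq q u
    obtain ⟨Y, hY, rfl⟩ := exists_isSmoothField_apply_eq q v
    obtain ⟨Z, hZ, rfl⟩ := exists_isSmoothField_apply_eq q w
    obtain ⟨W, hW, rfl⟩ := exists_isSmoothField_apply_eq q z
    simp only [← connectionCurvature_apply hnabla.smooth hX hY _ hΓ, hZ, hW]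
    exact hnabla.metric_curvature_swap hX hY hZ hW q
  bianchi u v w z := by
    obtain ⟨X, hX, rfl⟩ := exists_isSmoothField_apply_eq q u
    obtain ⟨Y, hY, rfl⟩ := exists_isSmoothField_apply_eq q v
    obtain ⟨Z, hZ, rfl⟩ := exists_isSmoothField_apply_eq q w
    rw [← connectionCurvature_apply hnabla.smooth hX hY hZ hΓ,
      ← connectionCurvature_apply hnabla.smooth hY hZ hX hΓ,
      ← connectionCurvature_apply hnabla.smooth hZ hX hY hΓ, ← add_apply, ← map_add, ← add_apply,
      ← map_add, hnabla.curvature_bianchi hX hY hZ q, map_zero, zero_apply]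

theorem HasConstantSectionalCurvature.metric_curvatureOfForm {c : ℝ}
    (hc : HasConstantSectionalCurvature g nabla c) (hnabla : nabla.ContMDiffCovariantDerivative ∞)
    (hΓ : IsConnectionForm nabla q Γ) (u v : TangentSpace 𝓘(ℝ, F) q)
    (huv : gramDet (g.val q).toBilinForm u v ≠ 0) :
    g.val q (curvatureOfForm Γ q u v v) u = c * gramDet (g.val q).toBilinForm u v := by
  obtain ⟨X, hX, rfl⟩ := exists_isSmoothField_apply_eq q u
  obtain ⟨Y, hY, rfl⟩ := exists_isSmoothField_apply_eq q v
  rw [← connectionCurvature_apply hnabla hX hY hY hΓ]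
  exact (div_eq_iff huv).1 (hc X Y hX hY q huv)

theorem HasConstantSectionalCurvature.curvatureOfForm_eq {c : ℝ}
    (hc : HasConstantSectionalCurvature g nabla c) (hnabla : IsLeviCivita g nabla)
    (hΓ : IsConnectionForm nabla q Γ) {u₀ v₀ : TangentSpace 𝓘(ℝ, F) q}
    (h₀ : gramDet (g.val q).toBilinForm u₀ v₀ ≠ 0) (u v w : TangentSpace 𝓘(ℝ, F) q) :
    curvatureOfForm Γ q u v w = c • (g.val q v w • u - g.val q u w • v) := by
  have hK := (hnabla.isAlgebraicCurvatureTensor hΓ).sub_const_mul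
    (isAlgebraicCurvatureTensor_of_bilinForm (B := (g.val q).toBilinForm) (g.symm q)) c
  have hzero := hK.eq_zero_of_nondegenerate (g.val q).toBilinForm (fun u v huv ↦ by
    rw [hc.metric_curvatureOfForm hnabla.smooth hΓ u v huv, gramDet]
    simp only [ContinuousLinearMap.toBilinForm_apply, g.symm q v u]
    ring) h₀ u v w
  refine sub_eq_zero.1 (g.nondegenerate q _ fun z ↦ Eq.trans ?_ (hzero z))
  simp only [map_sub, map_smul, sub_apply, smul_apply, smul_eq_mul,
    ContinuousLinearMap.toBilinForm_apply]

end ConstantCurvature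

/-! ### The transversal decomposition -/

theorem mfderiv_injective_of_isImmersion {N : Type*} [TopologicalSpace N] [ChartedSpace F N]
    {ι : M → N} (hι : Manifold.IsImmersion 𝓘(ℝ, E) 𝓘(ℝ, F) ∞ ι) (x : M) :
    Function.Injective (mfderiv% ι x) := by
  have hx := hι.isImmersionAt x
  have hdom : hx.domChart.MDifferentiable 𝓘(ℝ, E) 𝓘(ℝ, E) :=
    ⟨(contMDiffOn_of_mem_maximalAtlas hx.domChart_mem_maximalAtlas).mdifferentiableOn (by simp),
      (contMDiffOn_symm_of_mem_maximalAtlas hx.domChart_mem_maximalAtlas).mdifferentiableOn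
        (by simp)⟩
  have hcod : MDiffAt hx.codChart (ι x) :=
    ((contMDiffOn_of_mem_maximalAtlas hx.codChart_mem_maximalAtlas).contMDiffAt
      (hx.codChart.open_source.mem_nhds hx.mem_codChart_source)).mdifferentiableAt (by simp)
  let L : E →L[ℝ] F := (hx.equiv : (E × hx.complement) →L[ℝ] F) ∘L ContinuousLinearMap.inl ℝ E _
  have hL : Function.Injective L := hx.equiv.injective.comp (Prod.mk_left_injective 0)
  have hlocal : (hx.codChart ∘ ι) =ᶠ[𝓝 x] L ∘ hx.domChart := by
    filter_upwards [hx.domChart.open_source.mem_nhds hx.mem_domChart_source] with y hy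
    have hmem : hx.domChart y ∈ (hx.domChart.extend 𝓘(ℝ, E)).target := by
      simpa using hx.domChart.map_source hy
    simpa [hx.domChart.left_inv hy, L] using hx.writtenInCharts hmem
  have hderiv := hlocal.mfderiv_eq (I := 𝓘(ℝ, E)) (I' := 𝓘(ℝ, F))
  rw [mfderiv_comp x hcod ((hι.contMDiff x).mdifferentiableAt (by simp)),
    mfderiv_comp x L.differentiableAt.mdifferentiableAt
      (hdom.mdifferentiableAt hx.mem_domChart_source), mfderiv_eq_fderiv, L.fderiv] at hderiv
  have hinj : Function.Injective (L ∘L (mfderiv% hx.domChart x : E →L[ℝ] E)) :=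
    hL.comp (hdom.mfderiv_injective hx.mem_domChart_source)
  have happly (u : E) := congrArg (fun T : E →L[ℝ] F ↦ T u) (hderiv : (_ : E →L[ℝ] F) = _)
  refine Function.Injective.of_comp (f := mfderiv% hx.codChart (ι x)) fun u v huv ↦ hinj ?_
  exact (happly u).symm.trans (huv.trans (happly v))

section Pointwise

variable {g : SemiRiemannianMetric F N} {ι : M → N} {x : M}

theorem inducedMetric_symm (u v : TangentSpace 𝓘(ℝ, E) x) :
    inducedMetric g ι x u v = inducedMetric g ι x v u :=
  g.symm _ _ _

theorem inducedMetric_add_left (u u' v : TangentSpace 𝓘(ℝ, E) x) :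
    inducedMetric g ι x (u + u') v = inducedMetric g ι x u v + inducedMetric g ι x u' v := by
  simp [inducedMetric]

theorem inducedMetric_sub_left (u u' v : TangentSpace 𝓘(ℝ, E) x) :
    inducedMetric g ι x (u - u') v = inducedMetric g ι x u v - inducedMetric g ι x u' v := by
  simp [inducedMetric]

theorem inducedMetric_smul_left (a : ℝ) (u v : TangentSpace 𝓘(ℝ, E) x) :
    inducedMetric g ι x (a • u) v = a * inducedMetric g ι x u v := by
  simp [inducedMetric]

variable [IsManifold 𝓘(ℝ, E) ∞ M]

theorem ScreenDistribution.mem_radical_of_orthogonal (S : ScreenDistribution (E := E) g ι)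
    {u : TangentSpace 𝓘(ℝ, E) x} (hu : ∀ s ∈ S.space x, inducedMetric g ι x u s = 0) :
    u ∈ radical g ι x := by
  obtain ⟨s, hs, r, hr, rfl⟩ : ∃ s ∈ S.space x, ∃ r ∈ radical g ι x, s + r = u :=
    Submodule.mem_sup.1 ((S.isCompl x).sup_eq_top ▸ Submodule.mem_top)
  have hs₀ : s = 0 := S.nondegenerate x s hs fun v hv ↦ by
    rw [← hu v hv, inducedMetric_add_left, hr v, add_zero]
  rwa [hs₀, zero_add]

/-- `ξ` spans the radical at `x`, and `n` is the null vector of the transversal line `tr(TM)_x`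
normalized by `gbar(ξ, n) = 1`. -/
structure IsNullPair (S : ScreenDistribution (E := E) g ι) (x : M) (ξ : TangentSpace 𝓘(ℝ, E) x)
    (n : TangentSpace 𝓘(ℝ, F) (ι x)) : Prop where
  span_eq : Submodule.span ℝ {ξ} = radical g ι x
  screen : ∀ s ∈ S.space x, g.val (ι x) (mfderiv% ι x s) n = 0
  null : g.val (ι x) n n = 0
  pairing : g.val (ι x) (mfderiv% ι x ξ) n = 1

namespace IsNullPair

variable {S : ScreenDistribution (E := E) g ι} {ξ : TangentSpace 𝓘(ℝ, E) x}
  {n : TangentSpace 𝓘(ℝ, F) (ι x)}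

theorem mem_radical (h : IsNullPair S x ξ n) : ξ ∈ radical g ι x :=
  h.span_eq ▸ Submodule.mem_span_singleton_self ξ

theorem metric_mfderiv (h : IsNullPair S x ξ n) (u : TangentSpace 𝓘(ℝ, E) x) :
    g.val (ι x) (mfderiv% ι x u) (mfderiv% ι x ξ) = 0 := by
  rw [g.symm]
  exact h.mem_radical u

theorem gramDet_ne_zero (h : IsNullPair S x ξ n) :
    gramDet (g.val (ι x)).toBilinForm (mfderiv% ι x ξ) n ≠ 0 := by
  simp [gramDet, h.null, h.pairing]

theorem metric_add (h : IsNullPair S x ξ n) (u : TangentSpace 𝓘(ℝ, E) x) (t : ℝ) :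
    g.val (ι x) (mfderiv% ι x u + t • n) (mfderiv% ι x ξ) = t := by
  rw [map_add, add_apply, h.metric_mfderiv, map_smul, smul_apply, g.symm, h.pairing]
  simp

theorem eq_of_decomposition (h : IsNullPair S x ξ n) (hι : IsLightlikeHypersurface (E := E) g ι)
    {u u' : TangentSpace 𝓘(ℝ, E) x} {t t' : ℝ}
    (he : mfderiv% ι x u + t • n = mfderiv% ι x u' + t' • n) : u = u' ∧ t = t' := by
  obtain rfl : t = t' := by rw [← h.metric_add u t, he, h.metric_add]
  exact ⟨mfderiv_injective_of_isImmersion hι.immersion x (add_right_cancel he), rfl⟩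

variable [FiniteDimensional ℝ E]

theorem exists_decomposition (h : IsNullPair S x ξ n) (hι : IsLightlikeHypersurface (E := E) g ι)
    (V : TangentSpace 𝓘(ℝ, F) (ι x)) : ∃ u : TangentSpace 𝓘(ℝ, E) x,
      V = mfderiv% ι x u + g.val (ι x) V (mfderiv% ι x ξ) • n := by
  have : FiniteDimensional ℝ F := Module.finite_of_finrank_pos (by rw [hι.codim]; omega)
  let Ψ : E × ℝ →ₗ[ℝ] F :=
    (mfderiv% ι x : E →L[ℝ] F).toLinearMap.coprod (LinearMap.toSpanSingleton ℝ F n)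
  have hΨ : Function.Injective Ψ := fun p p' hp ↦ by
    obtain ⟨h₁, h₂⟩ := h.eq_of_decomposition hι hp
    exact Prod.ext h₁ h₂
  have hsurj := (LinearMap.injective_iff_surjective_of_finrank_eq_finrank
    (by simp [hι.codim])).1 hΨ
  obtain ⟨u, t, rfl⟩ : ∃ (u : TangentSpace 𝓘(ℝ, E) x) (t : ℝ), mfderiv% ι x u + t • n = V :=
    Prod.exists.1 (hsurj V)
  exact ⟨u, by rw [h.metric_add]⟩

theorem eq_smul_of_null (h : IsNullPair S x ξ n) (hι : IsLightlikeHypersurface (E := E) g ι)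
    {m : TangentSpace 𝓘(ℝ, F) (ι x)} (hS : ∀ s ∈ S.space x, g.val (ι x) (mfderiv% ι x s) m = 0)
    (hnull : g.val (ι x) m m = 0) (hξ : g.val (ι x) m (mfderiv% ι x ξ) ≠ 0) :
    m = g.val (ι x) m (mfderiv% ι x ξ) • n := by
  obtain ⟨u, hu⟩ := h.exists_decomposition hι m
  set t := g.val (ι x) m (mfderiv% ι x ξ)
  have hrad : u ∈ radical g ι x := S.mem_radical_of_orthogonal fun s hs ↦ by
    have hsm := hS s hs
    rw [hu, map_add, map_smul, h.screen s hs, smul_zero, add_zero] at hsm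
    rw [inducedMetric_symm]
    exact hsm
  rw [← h.span_eq] at hrad
  obtain ⟨b, rfl⟩ := Submodule.mem_span_singleton.1 hrad
  have hb : 2 * b * t = 0 := by
    rw [hu, map_smul] at hnull
    simp only [map_add, add_apply, map_smul, smul_apply, smul_eq_mul, h.metric_mfderiv,
      g.symm _ n, h.pairing, h.null] at hnull
    linear_combination hnull
  have hb₀ : b = 0 := by simpa [hξ] using hb
  rw [hu, hb₀, zero_smul, map_zero, zero_add]

theorem transversal_eq (h : IsNullPair S x ξ n) (hι : IsLightlikeHypersurface (E := E) g ι) :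
    transversal S x = Submodule.span ℝ {n} := by
  refine le_antisymm (Submodule.span_le.2 ?_) (Submodule.span_le.2 (Set.singleton_subset_iff.2
    (Submodule.subset_span ⟨h.screen, h.null, ξ, h.mem_radical, h.pairing⟩)))
  rintro m ⟨hS, hnull, η, hη, hηm⟩
  obtain ⟨a, rfl⟩ := Submodule.mem_span_singleton.1 (h.span_eq ▸ hη)
  have hξ : g.val (ι x) m (mfderiv% ι x ξ) ≠ 0 := fun h₀ ↦ by
    rw [map_smul, map_smul, smul_apply, g.symm, h₀, smul_zero] at hηm
    exact zero_ne_one hηm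
  rw [h.eq_smul_of_null hι hS hnull hξ]
  exact Submodule.smul_mem _ _ (Submodule.mem_span_singleton_self n)

theorem mfderiv_tangentialPart (h : IsNullPair S x ξ n)
    (hι : IsLightlikeHypersurface (E := E) g ι) (V : TangentSpace 𝓘(ℝ, F) (ι x)) :
    mfderiv% ι x (tangentialPart S x V) + g.val (ι x) V (mfderiv% ι x ξ) • n = V := by
  obtain ⟨u, hu⟩ := h.exists_decomposition hι V
  have hex : ∃ u, V - mfderiv% ι x u ∈ transversal S x := by
    refine ⟨u, ?_⟩
    rw [h.transversal_eq hι, sub_eq_iff_eq_add'.2 hu]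
    exact Submodule.smul_mem _ _ (Submodule.mem_span_singleton_self n)
  obtain ⟨t, ht⟩ := Submodule.mem_span_singleton.1
    ((h.transversal_eq hι).le (Classical.epsilon_spec hex))
  have hV : V = mfderiv% ι x (tangentialPart S x V) + t • n := eq_add_of_sub_eq' ht.symm
  rw [← (h.eq_of_decomposition hι (hu.symm.trans hV)).1]
  exact hu.symm

end IsNullPair

end Pointwise

section SmoothNullPairs

theorem contMDiffAt_fieldAlong_sub {ι : M → N} {x : M} (hι : CMDiffAt ∞ ι x)
    {V W : Π y : M, TangentSpace 𝓘(ℝ, F) (ι y)} (hV : CMDiffAt ∞ (fieldAlong ι V) x)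
    (hW : CMDiffAt ∞ (fieldAlong ι W) x) : CMDiffAt ∞ (fieldAlong ι fun y ↦ V y - W y) x := by
  have hx := mem_chart_source F (ι x)
  rw [contMDiffAt_fieldAlong_iff hx hι] at hV hW ⊢
  simpa only [map_sub] using hV.sub hW

theorem contMDiffAt_fieldAlong_smul {ι : M → N} {x : M} (hι : CMDiffAt ∞ ι x) {f : M → ℝ}
    (hf : CMDiffAt ∞ f x) {V : Π y : M, TangentSpace 𝓘(ℝ, F) (ι y)}
    (hV : CMDiffAt ∞ (fieldAlong ι V) x) : CMDiffAt ∞ (fieldAlong ι fun y ↦ f y • V y) x := by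
  have hx := mem_chart_source F (ι x)
  rw [contMDiffAt_fieldAlong_iff hx hι] at hV ⊢
  simp only [map_smul]
  exact hf.smul hV

theorem exists_contMDiffAt_fieldAlong_apply_eq {ι : M → N} {x : M} (hι : CMDiffAt ∞ ι x)
    (w : TangentSpace 𝓘(ℝ, F) (ι x)) :
    ∃ W : Π y : M, TangentSpace 𝓘(ℝ, F) (ι y), CMDiffAt ∞ (fieldAlong ι W) x ∧ W x = w := by
  have hx := mem_chart_source F (ι x)
  exact ⟨fun y ↦ coordSymm (ι x) (ι y) (coord (ι x) (ι x) w),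
    (contMDiffAt_coordSymm_const hx _).comp x hι, coordSymm_coord hx w⟩

theorem exists_contMDiffAt_solution {G : Type*} [NormedAddCommGroup G] [NormedSpace ℝ G]
    [FiniteDimensional ℝ G] {G' : Type*} [NormedAddCommGroup G'] [NormedSpace ℝ G']
    [FiniteDimensional ℝ G'] (hdim : Module.finrank ℝ G = Module.finrank ℝ G')
    {A : M → G →L[ℝ] G'} {r : M → G'} {x : M} (hinj : Function.Injective (A x))
    (hA : CMDiffAt ∞ A x) (hr : CMDiffAt ∞ r x) :
    ∃ s : M → G, CMDiffAt ∞ s x ∧ ∀ᶠ y in 𝓝 x, A y (s y) = r y ∧ ∀ z, A y z = r y → z = s y := by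
  have : CompleteSpace G := FiniteDimensional.complete ℝ G
  let e : G ≃L[ℝ] G' :=
    (LinearEquiv.ofInjectiveOfFinrankEq (A x).toLinearMap hinj hdim).toContinuousLinearEquiv
  have he : A x = e := by ext; rfl
  have hinv : ContDiffAt ℝ ∞ ContinuousLinearMap.inverse (A x) := he ▸ contDiffAt_map_inverse e
  refine ⟨fun y ↦ (A y).inverse (r y), (hinv.contMDiffAt.comp x hA).clm_apply hr, ?_⟩
  have hnhds : ∀ᶠ B in 𝓝 (A x), B ∈ Set.range ((↑) : (G ≃L[ℝ] G') → G →L[ℝ] G') :=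
    he ▸ ContinuousLinearEquiv.nhds e
  filter_upwards [hA.continuousAt.eventually hnhds] with y ⟨e', he'⟩
  simp only [← he', ContinuousLinearMap.inverse_equiv]
  exact ⟨e'.apply_symm_apply _, fun z hz ↦ hz ▸ (e'.symm_apply_apply z).symm⟩

variable {g : SemiRiemannianMetric F N} {ι : M → N}

theorem metric_mfderiv_eq_zero_of_mem_span {κ : Type*} {x : M} {s : κ → TangentSpace 𝓘(ℝ, E) x}
    {V : TangentSpace 𝓘(ℝ, F) (ι x)} (hs : ∀ i, g.val (ι x) (mfderiv% ι x (s i)) V = 0)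
    {v : TangentSpace 𝓘(ℝ, E) x} (hv : v ∈ Submodule.span ℝ (Set.range s)) :
    g.val (ι x) (mfderiv% ι x v) V = 0 := by
  have hle : Submodule.span ℝ (Set.range s) ≤
      LinearMap.ker ((g.val (ι x)).toBilinForm.flip V ∘ₗ (mfderiv% ι x).toLinearMap) :=
    Submodule.span_le.2 (Set.range_subset_iff.2 hs)
  exact hle hv

variable (g ι) in
/-- The operator on `ℝᵏ` whose matrix is the Gram matrix of the vector fields `s₁, …, sₖ` with
respect to the induced metric. -/
def gramOperator {k : ℕ} (s : Fin k → Π y : M, TangentSpace 𝓘(ℝ, E) y) (y : M) :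
    (Fin k → ℝ) →L[ℝ] (Fin k → ℝ) :=
  ∑ j, (ContinuousLinearMap.proj j).smulRight fun i ↦ inducedMetric g ι y (s i y) (s j y)

theorem gramOperator_apply {k : ℕ} (s : Fin k → Π y : M, TangentSpace 𝓘(ℝ, E) y) (y : M)
    (a : Fin k → ℝ) (i : Fin k) :
    gramOperator g ι s y a i = inducedMetric g ι y (s i y) (∑ j, a j • s j y) := by
  simp [gramOperator, inducedMetric, map_sum]

/-- For a null vector `v` and a vector `V` with `gbar(v, V) ≠ 0`, the null vector `n` in the plane
of `v` and `V` with `gbar(v, n) = 1`. -/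
def nullPartner (g : SemiRiemannianMetric F N) (q : N) (v V : TangentSpace 𝓘(ℝ, F) q) :
    TangentSpace 𝓘(ℝ, F) q :=
  (g.val q v V)⁻¹ • (V - (g.val q V V * (2 * g.val q v V)⁻¹) • v)

theorem contMDiffAt_nullPartner {x : M} (hι : CMDiffAt ∞ ι x)
    {v V : Π y : M, TangentSpace 𝓘(ℝ, F) (ι y)} (hv : CMDiffAt ∞ (fieldAlong ι v) x)
    (hV : CMDiffAt ∞ (fieldAlong ι V) x) (h : g.val (ι x) (v x) (V x) ≠ 0) :
    CMDiffAt ∞ (fieldAlong ι fun y ↦ nullPartner g (ι y) (v y) (V y)) x := by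
  have hvV := contMDiffAt_metric g hι hv hV
  have hinv := (contDiffAt_inv ℝ h).contMDiffAt.comp x hvV
  have hinv₂ := (contDiffAt_inv ℝ (mul_ne_zero two_ne_zero h)).contMDiffAt.comp x
    (contMDiffAt_const.mul hvV)
  exact contMDiffAt_fieldAlong_smul hι hinv (contMDiffAt_fieldAlong_sub hι hV
    (contMDiffAt_fieldAlong_smul hι ((contMDiffAt_metric g hι hV hV).mul hinv₂) hv))

variable [IsManifold 𝓘(ℝ, E) ∞ M]

theorem contMDiffAt_gramOperator {k : ℕ} {s : Fin k → Π y : M, TangentSpace 𝓘(ℝ, E) y} {x : M}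
    (hι : CMDiffAt ∞ ι x) (hs : ∀ i, CMDiffAt ∞ (T% (s i)) x) :
    CMDiffAt ∞ (gramOperator g ι s) x := by
  have hds (i) := contMDiffAt_mfderiv_apply hι (hs i)
  exact contMDiffAt_finsetSum fun j _ ↦ contMDiffAt_smulRight _
    (contMDiffAt_pi_space.2 fun i ↦ contMDiffAt_metric g hι (hds i) (hds j))

theorem ScreenDistribution.gramOperator_injective (S : ScreenDistribution (E := E) g ι) {k : ℕ}
    {s : Fin k → Π y : M, TangentSpace 𝓘(ℝ, E) y} {x : M}
    (hs : LinearIndependent ℝ fun i ↦ s i x)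
    (hspan : Submodule.span ℝ (Set.range fun i ↦ s i x) = S.space x) :
    Function.Injective (gramOperator g ι s x) := by
  refine (injective_iff_map_eq_zero (gramOperator g ι s x)).2 fun a ha ↦ ?_
  have hmem : ∑ j, a j • s j x ∈ S.space x := hspan ▸ Submodule.sum_mem _ fun j _ ↦
    Submodule.smul_mem _ _ (Submodule.subset_span ⟨j, rfl⟩)
  have hsum : ∑ j, a j • s j x = 0 := by
    refine S.nondegenerate x _ hmem fun v hv ↦ ?_
    rw [inducedMetric_symm]
    exact metric_mfderiv_eq_zero_of_mem_span
      (fun i ↦ (gramOperator_apply s x a i).symm.trans (congrFun ha i)) (hspan ▸ hv)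
  exact funext (Fintype.linearIndependent_iff.1 hs a hsum)

theorem ScreenDistribution.exists_orthogonalProjection (S : ScreenDistribution (E := E) g ι)
    {x : M} (hι : CMDiffAt ∞ ι x) {W : Π y : M, TangentSpace 𝓘(ℝ, F) (ι y)}
    (hW : CMDiffAt ∞ (fieldAlong ι W) x) :
    ∃ σ : Π y : M, TangentSpace 𝓘(ℝ, E) y, CMDiffAt ∞ (T% σ) x ∧ ∀ᶠ y in 𝓝 x,
      ∀ v ∈ S.space y, g.val (ι y) (mfderiv% ι y v) (W y - mfderiv% ι y (σ y)) = 0 := by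
  obtain ⟨k, hk⟩ := S.smooth
  obtain ⟨U, hU, s, hsU, hspan⟩ := hk x
  have hs (i) : CMDiffAt ∞ (T% (s i)) x := (hsU i).contMDiffAt hU
  have hx := hspan x (mem_of_mem_nhds hU)
  obtain ⟨a, ha, hsol⟩ := exists_contMDiffAt_solution rfl (S.gramOperator_injective hx.1 hx.2)
    (contMDiffAt_gramOperator hι hs)
    (contMDiffAt_pi_space.2 fun i ↦
      contMDiffAt_metric g hι (contMDiffAt_mfderiv_apply hι (hs i)) hW)
  refine ⟨fun y ↦ ∑ j, a y j • s j y,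
    ContMDiffAt.sum_section fun j _ ↦ (contMDiffAt_pi_space.1 ha j).smul_section (hs j), ?_⟩
  filter_upwards [hU, hsol] with y hy hay v hv
  refine metric_mfderiv_eq_zero_of_mem_span (fun i ↦ ?_) ((hspan y hy).2 ▸ hv)
  rw [map_sub, sub_eq_zero]
  exact (congrFun hay.1 i).symm.trans (gramOperator_apply s y (a y) i)

theorem isNullPair_nullPartner (S : ScreenDistribution (E := E) g ι) {x : M}
    {ξ : TangentSpace 𝓘(ℝ, E) x} {V : TangentSpace 𝓘(ℝ, F) (ι x)}
    (hξ : Submodule.span ℝ {ξ} = radical g ι x)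
    (hS : ∀ s ∈ S.space x, g.val (ι x) (mfderiv% ι x s) V = 0)
    (hV : g.val (ι x) (mfderiv% ι x ξ) V ≠ 0) :
    IsNullPair S x ξ (nullPartner g (ι x) (mfderiv% ι x ξ) V) := by
  have hrad (u) : g.val (ι x) (mfderiv% ι x ξ) (mfderiv% ι x u) = 0 :=
    (hξ ▸ Submodule.mem_span_singleton_self ξ : ξ ∈ radical g ι x) u
  refine ⟨hξ, fun s hs ↦ ?_, ?_, ?_⟩
  · rw [nullPartner, map_smul, map_sub, (g.val (ι x) (mfderiv% ι x s)).map_smul, hS s hs,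
      g.symm _ (mfderiv% ι x s), hrad, smul_zero, sub_zero, smul_zero]
  · simp only [nullPartner, map_smul, map_sub, smul_apply, sub_apply, hrad, g.symm _ V, smul_eq_mul]
    field_simp
    ring
  · rw [nullPartner, map_smul, map_sub, (g.val (ι x) (mfderiv% ι x ξ)).map_smul, hrad, smul_zero,
      sub_zero, smul_eq_mul, inv_mul_cancel₀ hV]

theorem IsLightlikeHypersurface.exists_span_eq_radical (hι : IsLightlikeHypersurface (E := E) g ι)
    (x : M) : ∃ ξ : Π y : M, TangentSpace 𝓘(ℝ, E) y, CMDiffAt ∞ (T% ξ) x ∧ ξ x ≠ 0 ∧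
      ∀ᶠ y in 𝓝 x, Submodule.span ℝ {ξ y} = radical g ι y := by
  obtain ⟨U, hU, Ξ, hΞs, hΞ⟩ := hι.radical_smooth x
  refine ⟨Ξ 0, (hΞs 0).contMDiffAt hU, (hΞ x (mem_of_mem_nhds hU)).1.ne_zero 0, ?_⟩
  filter_upwards [hU] with y hy
  rw [← (hΞ y hy).2, Set.range_unique]
  rfl

theorem exists_isNullPair (hι : IsLightlikeHypersurface (E := E) g ι)
    (S : ScreenDistribution (E := E) g ι) (x : M) :
    ∃ (ξ : Π y : M, TangentSpace 𝓘(ℝ, E) y) (n : Π y : M, TangentSpace 𝓘(ℝ, F) (ι y)),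
      CMDiffAt ∞ (T% ξ) x ∧ CMDiffAt ∞ (fieldAlong ι n) x ∧
      ∀ᶠ y in 𝓝 x, IsNullPair S y (ξ y) (n y) := by
  have hιx : CMDiffAt ∞ ι x := hι.immersion.contMDiff x
  obtain ⟨ξ, hξ, hξ₀, hspan⟩ := hι.exists_span_eq_radical x
  have hdξ := contMDiffAt_mfderiv_apply hιx hξ
  have hdξ₀ : mfderiv% ι x (ξ x) ≠ 0 := fun h ↦ hξ₀
    (mfderiv_injective_of_isImmersion hι.immersion x (h.trans (map_zero _).symm))
  obtain ⟨w, hw⟩ : ∃ w, g.val (ι x) (mfderiv% ι x (ξ x)) w ≠ 0 := by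
    by_contra! h
    exact hdξ₀ (g.nondegenerate _ _ h)
  obtain ⟨W, hW, rfl⟩ := exists_contMDiffAt_fieldAlong_apply_eq hιx w
  obtain ⟨σ, hσ, hortho⟩ := S.exists_orthogonalProjection hιx hW
  have hV := contMDiffAt_fieldAlong_sub hιx hW (contMDiffAt_mfderiv_apply hιx hσ)
  have hV₀ : g.val (ι x) (mfderiv% ι x (ξ x)) (W x - mfderiv% ι x (σ x)) ≠ 0 := by
    have hrad : ξ x ∈ radical g ι x :=
      hspan.self_of_nhds ▸ Submodule.mem_span_singleton_self (ξ x)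
    rwa [map_sub, show g.val (ι x) (mfderiv% ι x (ξ x)) (mfderiv% ι x (σ x)) = 0 from hrad (σ x),
      sub_zero]
  refine ⟨ξ, fun y ↦ nullPartner g (ι y) (mfderiv% ι y (ξ y)) (W y - mfderiv% ι y (σ y)), hξ,
    contMDiffAt_nullPartner hιx hdξ hV hV₀, ?_⟩
  filter_upwards [hspan, hortho, (contMDiffAt_metric g hιx hdξ hV).continuousAt.eventually_ne hV₀]
    with y hspan_y hortho_y hVy using isNullPair_nullPartner S hspan_y hortho_y hVy

section TangentialPart

/-- The map `(u, t) ↦ dι u + t n`, in the coordinates around `x` and `ι x`. -/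
def decompositionMap (ι : M → N) (n : Π y : M, TangentSpace 𝓘(ℝ, F) (ι y)) (x y : M) :
    E × ℝ →L[ℝ] F :=
  (coord (ι x) (ι y) ∘L mfderiv% ι y ∘L coordSymm x y) ∘L ContinuousLinearMap.fst ℝ E ℝ +
    (ContinuousLinearMap.snd ℝ E ℝ).smulRight (coord (ι x) (ι y) (n y))

theorem decompositionMap_coord (n : Π y : M, TangentSpace 𝓘(ℝ, F) (ι y)) {x y : M}
    (hy : y ∈ (chartAt E x).source) (u : TangentSpace 𝓘(ℝ, E) y) (t : ℝ) :
    decompositionMap ι n x y (coord x y u, t) = coord (ι x) (ι y) (mfderiv% ι y u + t • n y) := by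
  rw [map_add, map_smul]
  change coord (ι x) (ι y) (mfderiv% ι y (coordSymm x y (coord x y u))) + _ = _
  rw [coordSymm_coord hy]
  rfl

theorem contMDiffAt_decompositionMap {n : Π y : M, TangentSpace 𝓘(ℝ, F) (ι y)} {x : M}
    (hι : CMDiffAt ∞ ι x) (hn : CMDiffAt ∞ (fieldAlong ι n) x) :
    CMDiffAt ∞ (decompositionMap (E := E) ι n x) x := by
  have hD : CMDiffAt ∞
      (fun y ↦ (coord (ι x) (ι y) ∘L mfderiv% ι y ∘L coordSymm x y : E →L[ℝ] F)) x :=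
    hι.mfderiv_const (m := ∞) le_rfl
  refine ContMDiffAt.add ?_ (contMDiffAt_smulRight _
    ((contMDiffAt_fieldAlong_iff (mem_chart_source F (ι x)) hι).1 hn))
  exact contMDiffAt_clm_comp
    ((ContinuousLinearMap.compL ℝ (E × ℝ) E F).flip (ContinuousLinearMap.fst ℝ E ℝ)) hD

theorem IsNullPair.decompositionMap_injective {S : ScreenDistribution (E := E) g ι} {x : M}
    {ξ : TangentSpace 𝓘(ℝ, E) x} {n : Π y : M, TangentSpace 𝓘(ℝ, F) (ι y)}
    (h : IsNullPair S x ξ (n x)) (hι : IsLightlikeHypersurface (E := E) g ι) :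
    Function.Injective (decompositionMap (E := E) ι n x x) := by
  have hx := mem_chart_source E x
  rintro ⟨u, t⟩ ⟨u', t'⟩ heq
  rw [← coord_coordSymm hx u, ← coord_coordSymm hx u', decompositionMap_coord n hx,
    decompositionMap_coord n hx] at heq
  obtain ⟨hu, ht⟩ := h.eq_of_decomposition hι (coord_injective (mem_chart_source F (ι x)) heq)
  rw [← coord_coordSymm hx u, hu, coord_coordSymm hx, ht]

theorem contMDiffAt_tangentialPart [FiniteDimensional ℝ E] [FiniteDimensional ℝ F]
    (hι : IsLightlikeHypersurface (E := E) g ι) (S : ScreenDistribution (E := E) g ι) {x : M}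
    {V : Π y : M, TangentSpace 𝓘(ℝ, F) (ι y)} (hV : CMDiffAt ∞ (fieldAlong ι V) x) :
    CMDiffAt ∞ (T% (fun y ↦ tangentialPart S y (V y))) x := by
  have hιx : CMDiffAt ∞ ι x := hι.immersion.contMDiff x
  obtain ⟨ξ, n, -, hn, h⟩ := exists_isNullPair hι S x
  have hx := mem_chart_source E x
  obtain ⟨s, hs, hsol⟩ := exists_contMDiffAt_solution (by simp [hι.codim])
    (h.self_of_nhds.decompositionMap_injective hι) (contMDiffAt_decompositionMap hιx hn)
    ((contMDiffAt_fieldAlong_iff (mem_chart_source F (ι x)) hιx).1 hV)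
  refine (contMDiffAt_fieldAlong_iff (ι := fun y : M ↦ y) hx contMDiffAt_id).2 ?_
  refine (contMDiffAt_clm_comp (ContinuousLinearMap.fst ℝ E ℝ) hs).congr_of_eventuallyEq ?_
  filter_upwards [hsol, h, chart_source_mem_nhds E x] with y hy hny hyx
  refine congrArg Prod.fst (hy.2 (_, g.val (ι y) (V y) (mfderiv% ι y (ξ y))) ?_)
  rw [decompositionMap_coord n hyx, hny.mfderiv_tangentialPart hι]

end TangentialPart

end SmoothNullPairs

/-! ### The Gauss equation -/

section Gauss

section TangentialPart

variable [IsManifold 𝓘(ℝ, E) ∞ M] [FiniteDimensional ℝ E] {g : SemiRiemannianMetric F N}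
  {ι : M → N} {x : M}

theorem sub_mfderiv_tangentialPart_mem_transversal (hι : IsLightlikeHypersurface (E := E) g ι)
    (S : ScreenDistribution (E := E) g ι) (V : TangentSpace 𝓘(ℝ, F) (ι x)) :
    V - mfderiv% ι x (tangentialPart S x V) ∈ transversal S x := by
  obtain ⟨ξ, n, -, -, hn⟩ := exists_isNullPair hι S x
  have h := hn.self_of_nhds
  rw [h.transversal_eq hι, sub_eq_of_eq_add' (h.mfderiv_tangentialPart hι V).symm]
  exact Submodule.smul_mem _ _ (Submodule.mem_span_singleton_self _)

theorem tangentialPart_eq (hι : IsLightlikeHypersurface (E := E) g ι)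
    (S : ScreenDistribution (E := E) g ι) {V : TangentSpace 𝓘(ℝ, F) (ι x)}
    {u : TangentSpace 𝓘(ℝ, E) x} (hu : V - mfderiv% ι x u ∈ transversal S x) :
    tangentialPart S x V = u := by
  obtain ⟨ξ, n, -, -, hn⟩ := exists_isNullPair hι S x
  have h := hn.self_of_nhds
  obtain ⟨t, ht⟩ := Submodule.mem_span_singleton.1 ((h.transversal_eq hι).le hu)
  have hV : V = mfderiv% ι x u + t • n x := eq_add_of_sub_eq' ht.symm
  exact (h.eq_of_decomposition hι ((h.mfderiv_tangentialPart hι V).trans hV)).1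

theorem tangentialPart_mfderiv (hι : IsLightlikeHypersurface (E := E) g ι)
    (S : ScreenDistribution (E := E) g ι) (u : TangentSpace 𝓘(ℝ, E) x) :
    tangentialPart S x (mfderiv% ι x u) = u :=
  tangentialPart_eq hι S (by rw [sub_self]; exact zero_mem _)

theorem tangentialPart_eq_zero (hι : IsLightlikeHypersurface (E := E) g ι)
    (S : ScreenDistribution (E := E) g ι) {V : TangentSpace 𝓘(ℝ, F) (ι x)}
    (hV : V ∈ transversal S x) : tangentialPart S x V = 0 :=
  tangentialPart_eq hι S (by rwa [map_zero, sub_zero])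

theorem isLinearMap_tangentialPart (hι : IsLightlikeHypersurface (E := E) g ι)
    (S : ScreenDistribution (E := E) g ι) (x : M) : IsLinearMap ℝ (tangentialPart S x) where
  map_add V W := tangentialPart_eq hι S <| by
    rw [map_add, add_sub_add_comm]
    exact add_mem (sub_mfderiv_tangentialPart_mem_transversal hι S V)
      (sub_mfderiv_tangentialPart_mem_transversal hι S W)
  map_smul a V := tangentialPart_eq hι S <| by
    rw [map_smul, ← smul_sub]
    exact Submodule.smul_mem _ a (sub_mfderiv_tangentialPart_mem_transversal hι S V)

end TangentialPart

variable {g : SemiRiemannianMetric F N} {ι : M → N}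
  {nabla : CovariantDerivative 𝓘(ℝ, F) F (TangentSpace 𝓘(ℝ, F) : N → Type _)}

theorem covAlong_add_smul [FiniteDimensional ℝ F] [T2Space N]
    (hnabla : nabla.ContMDiffCovariantDerivative ∞) (hι : CMDiff ∞ ι) {x : M}
    {A B : Π y : M, TangentSpace 𝓘(ℝ, F) (ι y)} {f : M → ℝ} (hA : MDiffAt (fieldAlong ι A) x)
    (hB : MDiffAt (fieldAlong ι B) x) (hf : MDiffAt f x) (u : TangentSpace 𝓘(ℝ, E) x) :
    covAlong nabla ι (fun y ↦ A y + f y • B y) x u =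
      covAlong nabla ι A x u + f x • covAlong nabla ι B x u + d% f x u • B x := by
  obtain ⟨Γ, hΓ⟩ := exists_isConnectionForm hnabla (ι x)
  have hx := mem_chart_source F (ι x)
  have hιx : MDiffAt ι x := (hι x).mdifferentiableAt (by simp)
  have ha := (mdifferentiableAt_fieldAlong_iff hx hιx).1 hA
  have hb := (mdifferentiableAt_fieldAlong_iff hx hιx).1 hB
  have hfb : MDiffAt (fun y ↦ f y • coord (ι x) (ι y) (B y)) x := hf.smul hb
  have hsum : MDiffAt (fieldAlong ι fun y ↦ A y + f y • B y) x := by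
    rw [mdifferentiableAt_fieldAlong_iff hx hιx]
    simp only [map_add, map_smul]
    exact ha.add hfb
  have hleibniz : d% (fun y ↦ f y • coord (ι x) (ι y) (B y)) x u =
      d% f x u • coord (ι x) (ι x) (B x) + f x • d% (fun y ↦ coord (ι x) (ι y) (B y)) x u :=
    mvfderiv_clm_apply₂ (ContinuousLinearMap.lsmul ℝ ℝ) hf hb u
  have hcov {V : Π y : M, TangentSpace 𝓘(ℝ, F) (ι y)} (hV : MDiffAt (fieldAlong ι V) x) :=
    (hΓ.coord_covAlong hι).self_of_nhds V hV u
  apply coord_injective hx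
  simp only [map_add, map_smul, hcov hsum, hcov hA, hcov hB, mvfderiv_fun_add ha hfb, hleibniz,
    add_apply, smul_apply, smul_add]
  abel

theorem contMDiffAt_ambientDeriv [IsManifold 𝓘(ℝ, E) ∞ M] [FiniteDimensional ℝ F] [T2Space N]
    (hnabla : nabla.ContMDiffCovariantDerivative ∞) (hι : CMDiff ∞ ι)
    {X Y : Π y : M, TangentSpace 𝓘(ℝ, E) y} {x : M}
    (hX : CMDiffAt ∞ (T% X) x) (hY : CMDiffAt ∞ (T% Y) x) :
    CMDiffAt ∞ (fieldAlong ι (ambientDeriv nabla ι X Y)) x := by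
  obtain ⟨Γ, hΓ⟩ := exists_isConnectionForm hnabla (ι x)
  exact hΓ.contMDiffAt_covAlong hι (contMDiffAt_mfderiv_apply (hι x) hY) hX

section Umbilical

variable [IsManifold 𝓘(ℝ, E) ∞ M] [FiniteDimensional ℝ E] [FiniteDimensional ℝ F]

theorem IsTotallyUmbilical.exists_secondFundamentalForm_eq
    (humb : IsTotallyUmbilical (E := E) g nabla ι) (hι : IsLightlikeHypersurface (E := E) g ι)
    (S : ScreenDistribution (E := E) g ι) :
    ∃ H : Π x : M, TangentSpace 𝓘(ℝ, F) (ι x), CMDiff ∞ (fieldAlong ι H) ∧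
      (∀ x, H x ∈ transversal S x) ∧
      ∀ X Y : Π x : M, TangentSpace 𝓘(ℝ, E) x, IsSmoothField X → IsSmoothField Y → ∀ x : M,
        secondFundamentalForm nabla S X Y x = inducedMetric g ι x (X x) (Y x) • H x := by
  obtain ⟨S₀, H₀, hH₀, -, hh⟩ := humb
  refine ⟨fun x ↦ H₀ x - mfderiv% ι x (tangentialPart S x (H₀ x)), fun x ↦ ?_,
    fun x ↦ sub_mfderiv_tangentialPart_mem_transversal hι S (H₀ x), fun X Y hX hY x ↦ ?_⟩
  · have hιx : CMDiffAt ∞ ι x := hι.immersion.contMDiff x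
    exact contMDiffAt_fieldAlong_sub hιx (hH₀ x)
      (contMDiffAt_mfderiv_apply hιx (contMDiffAt_tangentialPart hι S (hH₀ x)))
  · have hlin := isLinearMap_tangentialPart hι S x
    have hamb := sub_eq_iff_eq_add.1 (hh X Y hX hY x)
    simp only [secondFundamentalForm, inducedConnection] at hamb ⊢
    rw [hamb, hlin.map_add, hlin.map_smul, tangentialPart_mfderiv hι, map_add, map_smul, smul_sub]
    abel

variable [T2Space N]

theorem isSmoothField_inducedConnection (hnabla : nabla.ContMDiffCovariantDerivative ∞)
    (hι : IsLightlikeHypersurface (E := E) g ι) (S : ScreenDistribution (E := E) g ι)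
    {X Y : Π y : M, TangentSpace 𝓘(ℝ, E) y} (hX : IsSmoothField X) (hY : IsSmoothField Y) :
    IsSmoothField (inducedConnection nabla S X Y) := fun x ↦
  contMDiffAt_tangentialPart hι S
    (contMDiffAt_ambientDeriv hnabla hι.immersion.contMDiff (hX x) (hY x))

theorem isSmoothField_inducedCurvature (hnabla : nabla.ContMDiffCovariantDerivative ∞)
    (hι : IsLightlikeHypersurface (E := E) g ι) (S : ScreenDistribution (E := E) g ι)
    {X Y Z : Π y : M, TangentSpace 𝓘(ℝ, E) y} (hX : IsSmoothField X) (hY : IsSmoothField Y)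
    (hZ : IsSmoothField Z) : IsSmoothField (inducedCurvature nabla S X Y Z) := by
  have hD {X Y : Π y : M, TangentSpace 𝓘(ℝ, E) y} (hX : IsSmoothField X) (hY : IsSmoothField Y) :=
    isSmoothField_inducedConnection hnabla hι S hX hY
  exact ((hD hX (hD hY hZ)).sub_section (hD hY (hD hX hZ))).sub_section (hD (hX.mlieBracket hY) hZ)

theorem tangentialPart_covAlong_ambientDeriv (hnabla : nabla.ContMDiffCovariantDerivative ∞)
    (hι : IsLightlikeHypersurface (E := E) g ι) {S : ScreenDistribution (E := E) g ι}
    {H : Π x : M, TangentSpace 𝓘(ℝ, F) (ι x)} {x : M} (hH : CMDiffAt ∞ (fieldAlong ι H) x)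
    (hHt : H x ∈ transversal S x) {Y Z : Π y : M, TangentSpace 𝓘(ℝ, E) y} (hY : IsSmoothField Y)
    (hZ : IsSmoothField Z) (hh : ∀ y,
      secondFundamentalForm nabla S Y Z y = inducedMetric g ι y (Y y) (Z y) • H y)
    (X : Π y : M, TangentSpace 𝓘(ℝ, E) y) :
    tangentialPart S x (covAlong nabla ι (ambientDeriv nabla ι Y Z) x (X x)) =
      inducedConnection nabla S X (inducedConnection nabla S Y Z) x +
        inducedMetric g ι x (Y x) (Z x) • tangentialPart S x (covAlong nabla ι H x (X x)) := by
  have hιs : CMDiff ∞ ι := hι.immersion.contMDiff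
  have hlin := isLinearMap_tangentialPart hι S x
  have hgauss : ambientDeriv nabla ι Y Z = fun y ↦
      mfderiv% ι y (inducedConnection nabla S Y Z y) + inducedMetric g ι y (Y y) (Z y) • H y :=
    funext fun y ↦ eq_add_of_sub_eq' (hh y)
  have htan := contMDiffAt_mfderiv_apply (hιs x)
    (isSmoothField_inducedConnection hnabla hι S hY hZ x)
  have hmetric : CMDiffAt ∞ (fun y ↦ inducedMetric g ι y (Y y) (Z y)) x :=
    contMDiffAt_metric g (hιs x) (contMDiffAt_mfderiv_apply (hιs x) (hY x))
      (contMDiffAt_mfderiv_apply (hιs x) (hZ x))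
  rw [hgauss, covAlong_add_smul hnabla hιs (htan.mdifferentiableAt (by simp))
    (hH.mdifferentiableAt (by simp)) (hmetric.mdifferentiableAt (by simp)), hlin.map_add,
    hlin.map_add, hlin.map_smul, hlin.map_smul, tangentialPart_eq_zero hι S hHt, smul_zero,
    add_zero]
  rfl

theorem exists_inducedCurvature_eq (hnabla : IsLeviCivita g nabla) {c : ℝ}
    (hc : HasConstantSectionalCurvature g nabla c) (hι : IsLightlikeHypersurface (E := E) g ι)
    (humb : IsTotallyUmbilical (E := E) g nabla ι) (S : ScreenDistribution (E := E) g ι) (x : M) :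
    ∃ L : TangentSpace 𝓘(ℝ, E) x → TangentSpace 𝓘(ℝ, E) x,
      ∀ X Y Z : Π y : M, TangentSpace 𝓘(ℝ, E) y,
        IsSmoothField X → IsSmoothField Y → IsSmoothField Z →
        inducedCurvature nabla S X Y Z x = inducedMetric g ι x (Y x) (Z x) • L (X x) -
          inducedMetric g ι x (X x) (Z x) • L (Y x) := by
  obtain ⟨H, hH, hHt, hh⟩ := humb.exists_secondFundamentalForm_eq hι S
  obtain ⟨Γ, hΓ⟩ := exists_isConnectionForm hnabla.smooth (ι x)
  obtain ⟨ξ, n, -, -, hn⟩ := exists_isNullPair hι S x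
  have hιs : CMDiff ∞ ι := hι.immersion.contMDiff
  have hlin := isLinearMap_tangentialPart hι S x
  refine ⟨fun u ↦ c • u - tangentialPart S x (covAlong nabla ι H x u), fun X Y Z hX hY hZ ↦ ?_⟩
  have hambient := congrArg (tangentialPart S x)
    (hΓ.curvature_along hιs (contMDiffAt_mfderiv_apply (hιs x) (hZ x)) (hX x) (hY x))
  rw [hc.curvatureOfForm_eq hnabla hΓ hn.self_of_nhds.gramDet_ne_zero, hlin.map_sub, hlin.map_sub,
    hlin.map_smul, hlin.map_sub, hlin.map_smul, hlin.map_smul, tangentialPart_mfderiv hι,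
    tangentialPart_mfderiv hι] at hambient
  have hXY := tangentialPart_covAlong_ambientDeriv hnabla.smooth hι (hH x) (hHt x) hY hZ
    (hh Y Z hY hZ) X
  have hYX := tangentialPart_covAlong_ambientDeriv hnabla.smooth hι (hH x) (hHt x) hX hZ
    (hh X Z hX hZ) Y
  change tangentialPart S x (covAlong nabla ι (ambientDeriv nabla ι Y Z) x (X x)) -
    tangentialPart S x (covAlong nabla ι (ambientDeriv nabla ι X Z) x (Y x)) -
    inducedConnection nabla S (VectorField.mlieBracket 𝓘(ℝ, E) X Y) Z x =
    c • (inducedMetric g ι x (Y x) (Z x) • X x - inducedMetric g ι x (X x) (Z x) • Y x) at hambient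
  rw [hXY, hYX] at hambient
  simp only [inducedCurvature, curvature]
  linear_combination (norm := module) hambient

end Umbilical

end Gauss

/-! ### Semi-symmetry -/

section PairSymmetry

variable {K V : Type*} [Field K] [AddCommGroup V] [Module K V] {B : LinearMap.BilinForm K V}
  {L : V → V}

theorem exists_apply_map_eq_mul_left_of_pair_symm
    (hpair : ∀ u v w z,
      B v w * B (L u) z - B u w * B (L v) z = B z u * B (L w) v - B w u * B (L z) v) (w : V) :
    ∃ r : K, ∀ u, B (L u) w = r * B u w := by
  by_cases hw : ∀ u, B u w = 0
  · exact ⟨0, fun u ↦ by rw [hw, hw, mul_zero]⟩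
  obtain ⟨v, hv⟩ := not_forall.1 hw
  refine ⟨B (L v) w / B v w, fun u ↦ ?_⟩
  have hdiag : B v w * B (L u) w - B u w * B (L v) w = 0 := (hpair u v w w).trans (sub_self _)
  field_simp
  linear_combination hdiag

theorem exists_apply_map_eq_mul_of_pair_symm [Invertible (2 : K)] (hB : LinearMap.IsSymm B)
    (hpair : ∀ u v w z,
      B v w * B (L u) z - B u w * B (L v) z = B z u * B (L w) v - B w u * B (L z) v) :
    ∃ μ : K, ∀ u w, B (L u) w = μ * B u w := by
  obtain rfl | hB₀ := eq_or_ne B 0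
  · exact ⟨0, by simp⟩
  obtain ⟨a, ha⟩ := LinearMap.BilinForm.exists_bilinForm_self_ne_zero hB₀ hB
  have hsymm (u v : V) : B u v = B v u := hB.eq u v
  choose r hr using exists_apply_map_eq_mul_left_of_pair_symm hpair
  refine ⟨r a, fun u w ↦ ?_⟩
  obtain h | h := eq_or_ne (r w) (r a)
  · rw [hr, h]
  -- if the two factors differ, `w` is a multiple of `a` modulo the radical of `B`
  have hw (z : V) : B w z * B a a = B a z * B w a := by
    refine sub_eq_zero.1 ((mul_eq_zero.1 ?_).resolve_left (sub_ne_zero.2 h))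
    have hwz := hpair a w z a
    rw [hr, hr, hr, hr, hsymm z w, hsymm z a, hsymm a w] at hwz
    linear_combination -hwz
  have hwL := hw (L u)
  rw [hsymm w, hsymm a (L u), hr a u] at hwL
  have hwu := hw u
  rw [hsymm w u, hsymm a u] at hwu
  exact mul_right_cancel₀ ha (by linear_combination hwL - r a * hwu)

end PairSymmetry

section SemiSymmetry

/-- The metric induced on `T_x M`, as a bilinear form. -/
def inducedBilinForm (g : SemiRiemannianMetric F N) (ι : M → N) (x : M) :
    LinearMap.BilinForm ℝ (TangentSpace 𝓘(ℝ, E) x) :=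
  (g.val (ι x)).toBilinForm.compl₁₂ (mfderiv% ι x).toLinearMap (mfderiv% ι x).toLinearMap

theorem isSymm_inducedBilinForm (g : SemiRiemannianMetric F N) (ι : M → N) (x : M) :
    LinearMap.IsSymm (inducedBilinForm (E := E) g ι x) :=
  ⟨fun u v ↦ inducedMetric_symm u v⟩

variable [IsManifold 𝓘(ℝ, E) ∞ M] {g : SemiRiemannianMetric F N} {ι : M → N}
  {nabla : CovariantDerivative 𝓘(ℝ, F) F (TangentSpace 𝓘(ℝ, F) : N → Type _)}
  {S : ScreenDistribution (E := E) g ι}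

/-- The induced curvature form is pointwise that of a space of constant curvature; the factor `μ`
may vary from point to point. -/
def HasPointwiseConstantCurvature
    (nabla : CovariantDerivative 𝓘(ℝ, F) F (TangentSpace 𝓘(ℝ, F) : N → Type _))
    (S : ScreenDistribution (E := E) g ι) : Prop :=
  ∀ x : M, ∃ μ : ℝ, ∀ X Y Z W : Π y : M, TangentSpace 𝓘(ℝ, E) y,
    IsSmoothField X → IsSmoothField Y → IsSmoothField Z → IsSmoothField W →
      inducedCurvatureForm nabla S X Y Z W x = μ *
        (inducedMetric g ι x (Y x) (Z x) * inducedMetric g ι x (X x) (W x) -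
          inducedMetric g ι x (X x) (Z x) * inducedMetric g ι x (Y x) (W x))

theorem HasPointwiseConstantCurvature.isSemiSymmetric (h : HasPointwiseConstantCurvature nabla S)
    (hsmooth : ∀ X Y Z : Π y : M, TangentSpace 𝓘(ℝ, E) y, IsSmoothField X → IsSmoothField Y →
      IsSmoothField Z → IsSmoothField (inducedCurvature nabla S X Y Z)) :
    IsSemiSymmetric nabla S := by
  intro V₁ V₂ X Y Z T hV₁ hV₂ hX hY hZ hT x
  obtain ⟨μ, hμ⟩ := h x
  have hR {U : Π y : M, TangentSpace 𝓘(ℝ, E) y} (hU : IsSmoothField U) := hsmooth V₁ V₂ U hV₁ hV₂ hU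
  have hskew {U W : Π y : M, TangentSpace 𝓘(ℝ, E) y} (hU : IsSmoothField U)
      (hW : IsSmoothField W) :
      inducedMetric g ι x (inducedCurvature nabla S V₁ V₂ U x) (W x) +
        inducedMetric g ι x (U x) (inducedCurvature nabla S V₁ V₂ W x) = 0 := by
    have hUW := hμ V₁ V₂ U W hV₁ hV₂ hU hW
    have hWU := hμ V₁ V₂ W U hV₁ hV₂ hW hU
    rw [inducedCurvatureForm] at hUW hWU
    rw [inducedMetric_symm (U x), hUW, hWU]
    ring
  rw [curvatureDerivation, hμ _ _ _ _ (hR hX) hY hZ hT, hμ _ _ _ _ hX (hR hY) hZ hT,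
    hμ _ _ _ _ hX hY (hR hZ) hT, hμ _ _ _ _ hX hY hZ (hR hT)]
  linear_combination μ *
    (inducedMetric g ι x (X x) (Z x) * hskew hY hT + inducedMetric g ι x (Y x) (T x) * hskew hX hZ -
      inducedMetric g ι x (Y x) (Z x) * hskew hX hT - inducedMetric g ι x (X x) (T x) * hskew hY hZ)

theorem IsAdmissible.hasPointwiseConstantCurvature [FiniteDimensional ℝ E] [FiniteDimensional ℝ F]
    [T2Space M] [T2Space N] (hS : IsAdmissible nabla S) (hnabla : IsLeviCivita g nabla) {c : ℝ}
    (hc : HasConstantSectionalCurvature g nabla c) (hι : IsLightlikeHypersurface (E := E) g ι)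
    (humb : IsTotallyUmbilical (E := E) g nabla ι) : HasPointwiseConstantCurvature nabla S := by
  intro x
  obtain ⟨L, hL⟩ := exists_inducedCurvature_eq hnabla hc hι humb S x
  have hform {X Y Z W : Π y : M, TangentSpace 𝓘(ℝ, E) y} (hX : IsSmoothField X)
      (hY : IsSmoothField Y) (hZ : IsSmoothField Z) :
      inducedCurvatureForm nabla S X Y Z W x =
        inducedMetric g ι x (Y x) (Z x) * inducedMetric g ι x (L (X x)) (W x) -
          inducedMetric g ι x (X x) (Z x) * inducedMetric g ι x (L (Y x)) (W x) := by
    rw [inducedCurvatureForm, hL X Y Z hX hY hZ, inducedMetric_sub_left, inducedMetric_smul_left,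
      inducedMetric_smul_left]
  obtain ⟨μ, hμ⟩ := exists_apply_map_eq_mul_of_pair_symm (L := L) (isSymm_inducedBilinForm g ι x)
    fun u v w z ↦ by
      obtain ⟨X, hX, rfl⟩ := exists_isSmoothField_apply_eq (F := E) x u
      obtain ⟨Y, hY, rfl⟩ := exists_isSmoothField_apply_eq (F := E) x v
      obtain ⟨Z, hZ, rfl⟩ := exists_isSmoothField_apply_eq (F := E) x w
      obtain ⟨W, hW, rfl⟩ := exists_isSmoothField_apply_eq (F := E) x z
      exact (hform hX hY hZ).symm.trans ((hS X Y Z W hX hY hZ hW x).2.1.trans (hform hZ hW hX))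
  replace hμ (u w : TangentSpace 𝓘(ℝ, E) x) :
      inducedMetric g ι x (L u) w = μ * inducedMetric g ι x u w := hμ u w
  refine ⟨μ, fun X Y Z W hX hY hZ _ ↦ ?_⟩
  rw [hform hX hY hZ, hμ, hμ]
  ring

end SemiSymmetry

end

end LightlikeGeometry

theorem theorem5p2
    {E : Type*} [NormedAddCommGroup E] [NormedSpace ℝ E] [FiniteDimensional ℝ E]
    {F : Type*} [NormedAddCommGroup F] [NormedSpace ℝ F] [FiniteDimensional ℝ F]
    {M : Type*} [TopologicalSpace M] [T2Space M] [ChartedSpace E M] [IsManifold 𝓘(ℝ, E) ∞ M]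
    {N : Type*} [TopologicalSpace N] [T2Space N] [ChartedSpace F N] [IsManifold 𝓘(ℝ, F) ∞ N]
    (g : LightlikeGeometry.SemiRiemannianMetric F N)
    (nabla : CovariantDerivative 𝓘(ℝ, F) F (TangentSpace 𝓘(ℝ, F) : N → Type _))
    (hnabla : LightlikeGeometry.IsLeviCivita g nabla)
    (c : ℝ) (hc : LightlikeGeometry.HasConstantSectionalCurvature g nabla c)
    (ι : M → N) (hι : LightlikeGeometry.IsLightlikeHypersurface (E := E) g ι)
    (humb : LightlikeGeometry.IsTotallyUmbilical (E := E) g nabla ι)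
    (S : LightlikeGeometry.ScreenDistribution (E := E) g ι)
    (hS : LightlikeGeometry.IsAdmissible nabla S) :
    LightlikeGeometry.IsSemiSymmetric nabla S :=
  (hS.hasPointwiseConstantCurvature hnabla hc hι humb).isSemiSymmetric fun _ _ _ ↦
    LightlikeGeometry.isSmoothField_inducedCurvature hnabla.smooth hι S
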